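/- **Theorem 2.6 (Abstract framework).** Let $N\ge 1$, and let $\operatorname{Sub}_c(\mathbb{R}^N)$ be the set of all nonempty bounded open sets $\Omega\subset\mathbb{R}^N$ whose boundary is of class $C^{1,1}$ (i.e. near each boundary point, after a rotation of coordinates, $\Omega$ is the region lying strictly below the graph of a $C^1$ function with Lipschitz derivative). Let $\mu:\operatorname{Sub}_c(\mathbb{R}^N)\to(0,\infty)$ be a function with the following properties. 1. (Reverse monotonicity) For all $\Omega_1,\Omega_2\in\operatorname{Sub}_c(\mathbb{R}^N)$ with $\Omega_1\subset\Omega_2$ we have $\mu(\Omega_2)\le\mu(\Omega_1)$. 2. (Outward flow continuity) For every $\Omega\in\operatorname{Sub}_c(\mathbb{R}^N)$ and every $X\in C^\infty_c(\mathbb{R}^N,\mathbb{R}^N)$ which is everywhere outward pointing along $\partial\Omega$ (i.e. $X\cdot\mathcal{N}>0$ on $\partial\Omega$, where $\mathcal{N}$ is the outward unit normal), the global flow $\psi_t$ of $X$ satisfies $\lim_{t\searrow 0}\mu(\psi_t(\Omega))=\mu(\Omega)$. 3. (Disjoint minimality) For all $\Omega_1,\Omega_2\in\operatorname{Sub}_c(\mathbb{R}^N)$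 with $\overline{\Omega}_1\cap\overline{\Omega}_2=\emptyset$ we have $\mu(\Omega_1\cup\Omega_2)=\min\{\mu(\Omega_1),\mu(\Omega_2)\}$. 4. (Translation invariance) For every $x\in\mathbb{R}^N$ and every $\Omega\in\operatorname{Sub}_c(\mathbb{R}^N)$ we have $\mu(x+\Omega)=\mu(\Omega)$. For $r_0>0$ and $V\ge\omega_N r_0^N$, where $\omega_N$ is the volume of the unit ball of $\mathbb{R}^N$, let $S^V_{r_0}$ be the set of all $\Omega\in\operatorname{Sub}_c(\mathbb{R}^N)$ of volume $|\Omega|=V$ which satisfy the uniform ball condition with radius at least $r_0$, that is: for every $x_0\in\partial\Omega$ there are an open ball $B_{r}(y)\subset\Omega$ and a closed ball $\overline{B_{s}(z)}\subset\mathbb{R}^N\setminus\Omega$, with radii $r,s\ge r_0$, such that $x_0\in\partial B_r(y)$ and $x_0\in\partial B_s(z)$. Then for all $r_0>0$ and $V\ge\omega_N r_0^N$ the restriction $\mu|_{S^V_{r_0}}$ attains a global minimum: there is $\Omega_*\in S^V_{r_0}$ with $\mu(\Omega_*)\le\mu(\Omega)$ for all $\Omega\in S^V_{r_0}$. -/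

import Mathlib

open Set Filter Topology MeasureTheory
open scoped ContDiff RealInnerProductSpace

namespace BallDomain

/-- `Ω ∩ B_r(x)` is the part of the ball `B_r(x)` lying strictly below the graph of the
`C^{1,1}` function `φ` (continuously differentiable with Lipschitz derivative), where the unit
vector `e` is the vertical direction and `φ` is a function on the hyperplane `e^⊥`. -/
def IsC11Graph {N : ℕ} (Ω : Set (EuclideanSpace ℝ (Fin N))) (x : EuclideanSpace ℝ (Fin N))
    (r : ℝ) (e : EuclideanSpace ℝ (Fin N)) (φ : (Submodule.span ℝ {e})ᗮ → ℝ) : Prop :=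
  0 < r ∧ ‖e‖ = 1 ∧ ContDiff ℝ 1 φ ∧ (∃ K, LipschitzWith K (fderiv ℝ φ)) ∧
    Ω ∩ Metric.ball x r =
      {y ∈ Metric.ball x r | ⟪e, y⟫ < φ ((Submodule.span ℝ {e})ᗮ.orthogonalProjectionOnto y)}

/-- `∂Ω ∈ C^{1,1}`: near each boundary point, after a rotation of coordinates, `Ω` is the
region on one side of the graph of a `C^{1,1}` function. -/
def HasC11Boundary {N : ℕ} (Ω : Set (EuclideanSpace ℝ (Fin N))) : Prop :=
  ∀ x ∈ frontier Ω, ∃ (r : ℝ) (e : EuclideanSpace ℝ (Fin N))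
    (φ : (Submodule.span ℝ {e})ᗮ → ℝ), IsC11Graph Ω x r e φ

/-- The class `Sub_c(ℝ^N)` of (nonempty) bounded open sets with `C^{1,1}` boundary. -/
def SubC (N : ℕ) : Set (Set (EuclideanSpace ℝ (Fin N))) :=
  {Ω | Ω.Nonempty ∧ IsOpen Ω ∧ Bornology.IsBounded Ω ∧ HasC11Boundary Ω}

/-- `n` is the outward unit normal of `Ω` at the boundary point `x`: where `Ω` is the region
below the graph of `φ` in direction `e`, this is the normalization of `e - ∇φ`. -/
def IsOutwardNormal {N : ℕ} (Ω : Set (EuclideanSpace ℝ (Fin N)))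
    (x n : EuclideanSpace ℝ (Fin N)) : Prop :=
  ∃ (r : ℝ) (e : EuclideanSpace ℝ (Fin N)) (φ : (Submodule.span ℝ {e})ᗮ → ℝ),
    IsC11Graph Ω x r e φ ∧
    ∃ w : EuclideanSpace ℝ (Fin N),
      w = e - ((gradient φ ((Submodule.span ℝ {e})ᗮ.orthogonalProjectionOnto x) :
        (Submodule.span ℝ {e})ᗮ) : EuclideanSpace ℝ (Fin N)) ∧
      n = ‖w‖⁻¹ • w

/-- The vector field `X` is everywhere outward pointing along `∂Ω`: `X · n > 0` on `∂Ω`, with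
`n` the outward unit normal. -/
def IsOutwardPointing {N : ℕ} (Ω : Set (EuclideanSpace ℝ (Fin N)))
    (X : EuclideanSpace ℝ (Fin N) → EuclideanSpace ℝ (Fin N)) : Prop :=
  ∀ x ∈ frontier Ω, ∃ n, IsOutwardNormal Ω x n ∧ 0 < ⟪X x, n⟫

/-- `ψ` is the global flow of the vector field `X`. -/
def IsGlobalFlow {N : ℕ} (X : EuclideanSpace ℝ (Fin N) → EuclideanSpace ℝ (Fin N))
    (ψ : ℝ → EuclideanSpace ℝ (Fin N) → EuclideanSpace ℝ (Fin N)) : Prop :=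
  ∀ x, ψ 0 x = x ∧ ∀ t, HasDerivAt (fun s => ψ s x) (X (ψ t x)) t

/-- Uniform interior ball condition, with all radii at least `r`. -/
def UniformInteriorBall {N : ℕ} (Ω : Set (EuclideanSpace ℝ (Fin N))) (r : ℝ) : Prop :=
  ∀ x ∈ frontier Ω, ∃ (y : EuclideanSpace ℝ (Fin N)) (ρ : ℝ), r ≤ ρ ∧
    Metric.ball y ρ ⊆ Ω ∧ x ∈ Metric.sphere y ρ

/-- Uniform exterior ball condition, with all radii at least `r`. -/
def UniformExteriorBall {N : ℕ} (Ω : Set (EuclideanSpace ℝ (Fin N))) (r : ℝ) : Prop :=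
  ∀ x ∈ frontier Ω, ∃ (y : EuclideanSpace ℝ (Fin N)) (ρ : ℝ), r ≤ ρ ∧
    Metric.closedBall y ρ ⊆ Ωᶜ ∧ x ∈ Metric.sphere y ρ

/-- The class `S_{r₀}` of the members of `Sub_c(ℝ^N)` that satisfy the uniform ball condition
with radius `r_Ω ≥ r₀`. -/
def SBall (N : ℕ) (r₀ : ℝ) : Set (Set (EuclideanSpace ℝ (Fin N))) :=
  {Ω ∈ SubC N | ∃ rΩ, r₀ ≤ rΩ ∧ UniformInteriorBall Ω rΩ ∧ UniformExteriorBall Ω rΩ}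

/-- The class `S^V_{r₀}` of the members of `S_{r₀}` of volume `V`. -/
def SBallVol (N : ℕ) (r₀ V : ℝ) : Set (Set (EuclideanSpace ℝ (Fin N))) :=
  {Ω ∈ SBall N r₀ | volume.real Ω = V}

end BallDomain

/-!
The minimizer is a limit of a minimizing sequence, and two-sided tangent balls are the notion that
makes each step of this work.

*Tangent balls.* By the uniform ball condition, each boundary point `x` of a domain `Ω` carries a
unit vector `ν` (`IsBallNormal`) such that the balls of radius `r` around `x - r ν` and `x + r ν`
lie inside and outside `Ω`. As the inner ball at one point never meets the outer ball at another,
the normals are `1/r`-Lipschitz and the boundary is quadratically close to its tangent planes.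
Hence it is locally the graph of a function with a quadratic Taylor estimate, that is, of class
`C^{1,1}` (`exists_isC11Graph`). So membership in `SubC` can be checked through tangent balls, for
limits of domains as well as for images under flows.

*Bounded minimizing sequences.* If `Ω` is disconnected, it splits into two sets with disjoint
closures that inherit the tangent balls, and `μ Ω` is the minimum of the two values. Repeating
this leaves a connected piece `A` with `μ A ≤ μ Ω` (`exists_isPreconnected_subset`). A connected
domain of volume at most `V` has bounded diameter. Translate `A` to the origin and replace all
other pieces by one distant ball of the same total volume, at a fixed place: this stays in the
class, does not increase `μ` above `μ Ω`, and gives uniformly bounded competitors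
(`exists_bounded_competitor`).

*Compactness.* The distance functions to the domains and to their complements are 1-Lipschitz, so
they converge along an ultrafilter. Tangent balls persist in the limit, the limit boundary is a
null set because it has no density points, and the volumes converge. The approximating domains are
eventually contained in each neighbourhood of the closure of the limit domain
(`exists_limit_sBallVol`).

*Semicontinuity.* Let `X` be a smooth field pointing outward along the boundary of the limit `Ω`,
with flow `ψ`. For small `t > 0` the set `ψ t '' Ω` is a neighbourhood of `closure Ω` and has
tangent balls of a smaller radius, because balls touching a trajectory can be transported along it
(`exists_flow_tangent_balls`). So it contains late members of the sequence, and reverse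
monotonicity bounds `μ (ψ t '' Ω)` by their values of `μ`; then `t` tends to `0`
(`le_of_forall_isOpen_exists_subset`).
-/

namespace BallDomain

/-! ### Two-sided tangent balls -/

section TangentBalls

variable {E : Type*} [NormedAddCommGroup E] [InnerProductSpace ℝ E]

/-- `ν` is a unit vector such that the two balls of radius `r` that touch each other at `x`, with
common axis `ν`, lie on different sides of `Ω`: the one in direction `-ν` inside `Ω`, the one in
direction `ν` outside. -/
def IsBallNormal (Ω : Set E) (r : ℝ) (x ν : E) : Prop :=
  ‖ν‖ = 1 ∧ Metric.ball (x - r • ν) r ⊆ Ω ∧ Metric.ball (x + r • ν) r ⊆ Ωᶜ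

/-- The two-sided ball condition with one common radius `r` at all boundary points. -/
def HasTwoSidedBalls (Ω : Set E) (r : ℝ) : Prop :=
  ∀ x ∈ frontier Ω, ∃ ν, IsBallNormal Ω r x ν

lemma mem_ball_sub_smul_iff {x ν y : E} {r : ℝ} (hr : 0 < r) (hν : ‖ν‖ = 1) :
    y ∈ Metric.ball (x - r • ν) r ↔ ‖y - x‖ ^ 2 + 2 * r * ⟪y - x, ν⟫ < 0 := by
  rw [Metric.mem_ball, dist_eq_norm, ← sq_lt_sq₀ (norm_nonneg _) hr.le,
    show y - (x - r • ν) = (y - x) + r • ν by abel, norm_add_sq_real, norm_smul, hν,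
    real_inner_smul_right, Real.norm_eq_abs, mul_one, sq_abs]
  constructor <;> intro h <;> linarith

lemma mem_ball_add_smul_iff {x ν y : E} {r : ℝ} (hr : 0 < r) (hν : ‖ν‖ = 1) :
    y ∈ Metric.ball (x + r • ν) r ↔ ‖y - x‖ ^ 2 < 2 * r * ⟪y - x, ν⟫ := by
  have h := mem_ball_sub_smul_iff (x := x) (y := y) hr (ν := -ν) (by rwa [norm_neg])
  rw [smul_neg, sub_neg_eq_add, inner_neg_right] at h
  rw [h]
  constructor <;> intro h <;> linarith

lemma ball_sub_smul_subset {x ν : E} {r s : ℝ} (hν : ‖ν‖ = 1) (hs : s ≤ r) :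
    Metric.ball (x - s • ν) s ⊆ Metric.ball (x - r • ν) r := by
  apply Metric.ball_subset_ball'
  rw [dist_eq_norm, show x - s • ν - (x - r • ν) = (r - s) • ν by module, norm_smul, hν,
    Real.norm_eq_abs, abs_of_nonneg (by linarith)]
  linarith

lemma IsBallNormal.mono {Ω : Set E} {r s : ℝ} {x ν : E} (h : IsBallNormal Ω r x ν)
    (hs : s ≤ r) : IsBallNormal Ω s x ν := by
  refine ⟨h.1, (ball_sub_smul_subset h.1 hs).trans h.2.1, ?_⟩
  have := ball_sub_smul_subset (x := x) (ν := -ν) (by rw [norm_neg, h.1]) hs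
  simp only [smul_neg, sub_neg_eq_add] at this
  exact this.trans h.2.2

lemma IsBallNormal.abs_inner_le {Ω : Set E} {r : ℝ} {x y ν : E} (hr : 0 < r)
    (h : IsBallNormal Ω r x ν) (hΩ : IsOpen Ω) (hy : y ∈ frontier Ω) :
    2 * r * |⟪y - x, ν⟫| ≤ ‖y - x‖ ^ 2 := by
  have h1 : y ∉ Metric.ball (x - r • ν) r := fun hb =>
    (hΩ.frontier_eq ▸ hy).2 (h.2.1 hb)
  have h2 : y ∉ Metric.ball (x + r • ν) r := fun hb => by
    obtain ⟨z, hz, hz'⟩ := mem_closure_iff.1 hy.1 _ Metric.isOpen_ball hb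
    exact h.2.2 hz hz'
  rw [mem_ball_sub_smul_iff hr h.1, not_lt] at h1
  rw [mem_ball_add_smul_iff hr h.1, not_lt] at h2
  rcases abs_cases ⟪y - x, ν⟫ with ⟨h, _⟩ | ⟨h, _⟩ <;> rw [h] <;> linarith

lemma two_mul_le_dist_of_disjoint_ball {a b : E} {r : ℝ} (hr : 0 < r)
    (h : Disjoint (Metric.ball a r) (Metric.ball b r)) : 2 * r ≤ dist a b := by
  have := (disjoint_ball_ball_iff hr hr).1 h
  linarith

/-- The normals are `1/r`-Lipschitz: the interior ball at each of the two points is disjoint from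
the exterior ball at the other one, and the two resulting inequalities add up to the claim by the
parallelogram law. In particular, normals are unique. -/
lemma IsBallNormal.norm_sub_le {Ω : Set E} {r : ℝ} {x y ν ξ : E} (hr : 0 < r)
    (hx : IsBallNormal Ω r x ν) (hy : IsBallNormal Ω r y ξ) : r * ‖ν - ξ‖ ≤ ‖x - y‖ := by
  have h1 : 2 * r ≤ ‖(x - y) - r • (ν + ξ)‖ := by
    have := two_mul_le_dist_of_disjoint_ball hr
      (disjoint_compl_right.mono hx.2.1 hy.2.2)
    rwa [dist_eq_norm, show x - r • ν - (y + r • ξ) = (x - y) - r • (ν + ξ) by module] at this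
  have h2 : 2 * r ≤ ‖(x - y) + r • (ν + ξ)‖ := by
    have := two_mul_le_dist_of_disjoint_ball hr
      (disjoint_compl_right.mono hy.2.1 hx.2.2)
    rwa [dist_comm, dist_eq_norm,
      show x + r • ν - (y - r • ξ) = (x - y) + r • (ν + ξ) by module] at this
  have h3 := parallelogram_law_with_norm ℝ (x - y) (r • (ν + ξ))
  have h4 := parallelogram_law_with_norm ℝ ν ξ
  rw [norm_smul, Real.norm_eq_abs, abs_of_pos hr] at h3
  rw [hx.1, hy.1] at h4
  have h5 : (r * ‖ν - ξ‖) ^ 2 ≤ ‖x - y‖ ^ 2 := by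
    nlinarith [mul_self_le_mul_self (by positivity) h1, mul_self_le_mul_self (by positivity) h2]
  exact (sq_le_sq₀ (by positivity) (norm_nonneg _)).1 h5

/-- A ball inside `Ω` and a ball outside `Ω` with a common boundary point lie opposite to each
other, since their centers have distance at least the sum of the radii. -/
lemma exists_isBallNormal_of_mem_sphere {Ω : Set E} {r ρ σ : ℝ} {x y z : E} (hr : 0 < r)
    (hρ : r ≤ ρ) (hσ : r ≤ σ) (hy : Metric.ball y ρ ⊆ Ω) (hz : Metric.ball z σ ⊆ Ωᶜ)
    (hxy : x ∈ Metric.sphere y ρ) (hxz : x ∈ Metric.sphere z σ) :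
    ∃ ν, IsBallNormal Ω r x ν ∧ y = x - ρ • ν := by
  have hρ0 : 0 < ρ := hr.trans_le hρ
  have hσ0 : 0 < σ := hr.trans_le hσ
  have hd := (disjoint_ball_ball_iff hρ0 hσ0).1 (disjoint_compl_right.mono hy hz)
  rw [mem_sphere_iff_norm] at hxy hxz
  have hν : ‖ρ⁻¹ • (x - y)‖ = 1 := by
    rw [norm_smul, hxy, Real.norm_eq_abs, abs_of_pos (inv_pos.2 hρ0), inv_mul_cancel₀ hρ0.ne']
  have hy' : y = x - ρ • (ρ⁻¹ • (x - y)) := by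
    rw [smul_smul, mul_inv_cancel₀ hρ0.ne']; module
  have hz' : z = x + σ • (ρ⁻¹ • (x - y)) := by
    have h1 : ρ + σ ≤ ‖(x - y) - (x - z)‖ := by
      rwa [dist_comm, dist_eq_norm, show z - y = (x - y) - (x - z) by abel] at hd
    have h2 : ‖σ • (x - y) + ρ • (x - z)‖ ^ 2 ≤ 0 := by
      have h3 := norm_sub_sq_real (x - y) (x - z)
      rw [norm_add_sq_real, norm_smul, norm_smul, real_inner_smul_left, real_inner_smul_right,
        hxy, hxz, Real.norm_eq_abs, Real.norm_eq_abs, abs_of_pos hρ0, abs_of_pos hσ0]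
      rw [hxy, hxz] at h3
      have h4 := mul_self_le_mul_self (by positivity) h1
      have h5 : ⟪x - y, x - z⟫ ≤ - (ρ * σ) := by nlinarith
      nlinarith [mul_pos hρ0 hσ0]
    have h3 : σ • (x - y) + ρ • (x - z) = 0 := by
      rw [← norm_eq_zero]; nlinarith [norm_nonneg (σ • (x - y) + ρ • (x - z))]
    have h4 : ρ • z = ρ • x + σ • (x - y) := by
      rw [← sub_eq_zero, ← neg_eq_zero, ← h3]; module
    rw [smul_smul, mul_comm, ← smul_smul, ← inv_smul_smul₀ hρ0.ne' z, h4, smul_add, inv_smul_smul₀ hρ0.ne']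
  refine ⟨ρ⁻¹ • (x - y), ⟨hν, ?_, ?_⟩, hy'⟩
  · refine (ball_sub_smul_subset hν hρ).trans ?_
    rwa [← hy']
  · have := ball_sub_smul_subset (x := x) (ν := -(ρ⁻¹ • (x - y))) (by rwa [norm_neg]) hσ
    rw [smul_neg, smul_neg, sub_neg_eq_add, sub_neg_eq_add, ← hz'] at this
    exact this.trans hz

lemma IsBallNormal.closedBall_subset_compl {Ω : Set E} {r : ℝ} {x ν : E} (hr : 0 < r)
    (h : IsBallNormal Ω r x ν) (hΩ : IsOpen Ω) :
    Metric.closedBall (x + r • ν) r ⊆ Ωᶜ := by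
  rw [← closure_ball _ hr.ne']
  exact closure_minimal h.2.2 hΩ.isClosed_compl

lemma mem_sphere_sub_smul {x ν : E} {r : ℝ} (hr : 0 < r) (hν : ‖ν‖ = 1) :
    x ∈ Metric.sphere (x - r • ν) r := by
  rw [mem_sphere_iff_norm, sub_sub_cancel, norm_smul, hν, Real.norm_eq_abs, abs_of_pos hr, mul_one]

lemma mem_sphere_add_smul {x ν : E} {r : ℝ} (hr : 0 < r) (hν : ‖ν‖ = 1) :
    x ∈ Metric.sphere (x + r • ν) r := by
  rw [mem_sphere_iff_norm, sub_add_cancel_left, norm_neg, norm_smul, hν, Real.norm_eq_abs,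
    abs_of_pos hr, mul_one]

end TangentBalls

/-! ### Functions with a global quadratic Taylor estimate -/

section Taylor

variable {E F : Type*} [NormedAddCommGroup E] [NormedSpace ℝ E] [NormedAddCommGroup F]
  [NormedSpace ℝ F]

/-- `A` is a derivative of `f` with a uniform quadratic error, on all pairs of points of `s`. -/
def HasQuadraticTaylorOn (f : E → F) (A : E → E →L[ℝ] F) (s : Set E) : Prop :=
  ∃ C : ℝ, 0 ≤ C ∧ ∀ x ∈ s, ∀ y ∈ s, ‖f y - f x - A x (y - x)‖ ≤ C * ‖y - x‖ ^ 2

lemma HasQuadraticTaylorOn.hasFDerivAt {f : E → F} {A : E → E →L[ℝ] F}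
    (h : HasQuadraticTaylorOn f A univ) (x : E) : HasFDerivAt f (A x) x := by
  obtain ⟨C, hC, h⟩ := h
  rw [hasFDerivAt_iff_isLittleO]
  have h1 : (fun y => f y - f x - A x (y - x)) =O[𝓝 x] fun y => ‖y - x‖ ^ 2 :=
    Asymptotics.IsBigO.of_bound C (Eventually.of_forall fun y => by
      rw [norm_pow, norm_norm]; exact h x trivial y trivial)
  refine h1.trans_isLittleO ?_
  rw [Asymptotics.isLittleO_iff]
  intro c hc
  filter_upwards [Metric.ball_mem_nhds x hc] with y hy
  rw [Metric.mem_ball, dist_eq_norm] at hy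
  rw [norm_pow, norm_norm, sq]
  gcongr

lemma HasQuadraticTaylorOn.exists_lipschitzWith {f : E → F} {A : E → E →L[ℝ] F}
    (h : HasQuadraticTaylorOn f A univ) : ∃ K, LipschitzWith K A := by
  obtain ⟨C, hC, h⟩ := h
  refine ⟨⟨6 * C, by positivity⟩, LipschitzWith.of_dist_le_mul fun y x => ?_⟩
  rw [dist_eq_norm, dist_eq_norm]
  change _ ≤ 6 * C * ‖y - x‖
  rcases eq_or_ne y x with rfl | hne
  · simp
  have hpos : 0 < ‖y - x‖ := norm_pos_iff.2 (sub_ne_zero.2 hne)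
  -- Test the difference on vectors as long as `y - x`, by expanding `f (y + v)` at `x` and at `y`.
  have key : ∀ v : E, ‖v‖ = ‖y - x‖ → ‖(A y - A x) v‖ ≤ 6 * C * ‖y - x‖ * ‖v‖ := by
    intro v hv
    have h1 := h x trivial (y + v) trivial
    have h2 := h y trivial (y + v) trivial
    have h3 := h x trivial y trivial
    have h4 : ‖y + v - x‖ ≤ 2 * ‖y - x‖ := by
      calc ‖y + v - x‖ = ‖(y - x) + v‖ := by congr 1; abel
        _ ≤ _ := norm_add_le _ _
        _ = _ := by rw [hv]; ring
    have h5 : ‖y + v - x‖ ^ 2 ≤ 4 * ‖y - x‖ ^ 2 := by nlinarith [norm_nonneg (y + v - x)]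
    rw [add_sub_cancel_left, hv] at h2
    have e : (A y - A x) v = (f (y + v) - f x - A x (y + v - x))
        - (f (y + v) - f y - A y v) - (f y - f x - A x (y - x)) := by
      rw [show y + v - x = (y - x) + v by abel, map_add, sub_apply]
      abel
    rw [e, hv]
    calc _ ≤ _ := (norm_sub_le _ _).trans (add_le_add_left (norm_sub_le _ _) _)
      _ ≤ C * (4 * ‖y - x‖ ^ 2) + C * ‖y - x‖ ^ 2 + C * ‖y - x‖ ^ 2 := by
        gcongr; exact h1.trans (by gcongr)
      _ = _ := by ring
  refine ContinuousLinearMap.opNorm_le_bound _ (by positivity) fun w => ?_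
  rcases eq_or_ne w 0 with rfl | hw
  · simp
  have hw' : 0 < ‖w‖ := norm_pos_iff.2 hw
  have h1 := key ((‖y - x‖ / ‖w‖) • w) (by
    rw [norm_smul, Real.norm_eq_abs, abs_of_pos (by positivity), div_mul_cancel₀ _ hw'.ne'])
  rw [map_smul, norm_smul, norm_smul, Real.norm_eq_abs, abs_of_pos (by positivity)] at h1
  have h2 : 0 < ‖y - x‖ / ‖w‖ := by positivity
  exact le_of_mul_le_mul_left (by linarith) h2

lemma HasQuadraticTaylorOn.fderiv_eq {f : E → F} {A : E → E →L[ℝ] F}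
    (h : HasQuadraticTaylorOn f A univ) : fderiv ℝ f = A :=
  funext fun x => (h.hasFDerivAt x).fderiv

lemma HasQuadraticTaylorOn.contDiff {f : E → F} {A : E → E →L[ℝ] F}
    (h : HasQuadraticTaylorOn f A univ) : ContDiff ℝ 1 f := by
  rw [contDiff_one_iff_fderiv, h.fderiv_eq]
  obtain ⟨K, hK⟩ := h.exists_lipschitzWith
  exact ⟨fun x => (h.hasFDerivAt x).differentiableAt, hK.continuous⟩

lemma hasQuadraticTaylorOn_of_hasCompactSupport {X : E → F} (hX : ContDiff ℝ 2 X)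
    (hc : HasCompactSupport X) : HasQuadraticTaylorOn X (fderiv ℝ X) univ := by
  have h1 : ContDiff ℝ 1 (fderiv ℝ X) := hX.fderiv_right (by norm_num)
  obtain ⟨K, hK⟩ := h1.lipschitzWith_of_hasCompactSupport (hc.fderiv ℝ) one_ne_zero
  refine ⟨K, K.2, fun x _ y _ => ?_⟩
  have hd := hX.differentiable (by norm_num)
  have := (convex_closedBall x ‖y - x‖).norm_image_sub_le_of_norm_hasFDerivWithin_le'
    (f := X) (f' := fderiv ℝ X) (φ := fderiv ℝ X x) (C := K * ‖y - x‖) (x := x) (y := y)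
    (fun z _ => (hd z).hasFDerivAt.hasFDerivWithinAt) (fun z hz => ?_) (by simp)
    (by simp [dist_eq_norm])
  · calc _ ≤ _ := this
      _ = _ := by ring
  · rw [← dist_eq_norm]
    refine (hK.dist_le_mul z x).trans ?_
    gcongr
    exact hz

/-- The quadratic estimate is trivial for bounded data and points with a fixed gap. -/
lemma norm_taylor_le_of_gap {f : E → F} {A : E → E →L[ℝ] F} {M₁ M₂ δ : ℝ} (hδ : 0 < δ)
    (hf : ∀ x, ‖f x‖ ≤ M₁) (hA : ∀ x, ‖A x‖ ≤ M₂) {x y : E} (hg : δ ≤ ‖y - x‖) :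
    ‖f y - f x - A x (y - x)‖ ≤ ((M₁ + M₁) * δ⁻¹ ^ 2 + M₂ * δ⁻¹) * ‖y - x‖ ^ 2 := by
  have hM₁ : 0 ≤ M₁ := (norm_nonneg _).trans (hf x)
  have hM₂ : 0 ≤ M₂ := (norm_nonneg _).trans (hA x)
  have h1 : 1 ≤ δ⁻¹ * ‖y - x‖ := by
    rw [inv_mul_eq_div, le_div_iff₀ hδ]; linarith
  have h2 : (1 : ℝ) ≤ (δ⁻¹ * ‖y - x‖) ^ 2 := one_le_pow₀ h1
  calc ‖f y - f x - A x (y - x)‖ ≤ (‖f y‖ + ‖f x‖) + ‖A x‖ * ‖y - x‖ :=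
        (norm_sub_le _ _).trans (add_le_add (norm_sub_le _ _) ((A x).le_opNorm _))
    _ ≤ (M₁ + M₁) + M₂ * ‖y - x‖ :=
        add_le_add (add_le_add (hf y) (hf x)) (mul_le_mul_of_nonneg_right (hA x) (norm_nonneg _))
    _ = (M₁ + M₁) * 1 + M₂ * ‖y - x‖ * 1 := by ring
    _ ≤ (M₁ + M₁) * (δ⁻¹ * ‖y - x‖) ^ 2 + M₂ * ‖y - x‖ * (δ⁻¹ * ‖y - x‖) :=
        add_le_add (mul_le_mul_of_nonneg_left h2 (by positivity))
          (mul_le_mul_of_nonneg_left h1 (by positivity))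
    _ = _ := by ring

lemma HasQuadraticTaylorOn.mono {f : E → F} {A : E → E →L[ℝ] F} {s t : Set E}
    (h : HasQuadraticTaylorOn f A t) (hst : s ⊆ t) : HasQuadraticTaylorOn f A s :=
  h.imp fun _ hC => ⟨hC.1, fun x hx y hy => hC.2 x (hst hx) y (hst hy)⟩

lemma HasQuadraticTaylorOn.mul {χ f : E → ℝ} {D A : E → E →L[ℝ] ℝ} {s : Set E} {M L K : ℝ}
    (hχ : HasQuadraticTaylorOn χ D s) (hf : HasQuadraticTaylorOn f A s)
    (hχ1 : ∀ x ∈ s, |χ x| ≤ 1) (hfM : ∀ x ∈ s, |f x| ≤ M)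
    (hL : ∀ x ∈ s, ∀ y ∈ s, |χ y - χ x| ≤ L * ‖y - x‖)
    (hK : ∀ x ∈ s, ∀ y ∈ s, |f y - f x| ≤ K * ‖y - x‖) :
    HasQuadraticTaylorOn (fun x => χ x * f x) (fun x => χ x • A x + f x • D x) s := by
  obtain ⟨C', hC', hχ⟩ := hχ
  obtain ⟨C, hC, h⟩ := hf
  refine ⟨|C + M * C' + L * K|, abs_nonneg _, fun x hx y hy => ?_⟩
  have e : χ y * f y - χ x * f x - (χ x • A x + f x • D x) (y - x) =
      χ x * (f y - f x - A x (y - x)) + f x * (χ y - χ x - D x (y - x))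
        + (χ y - χ x) * (f y - f x) := by
    simp only [add_apply, smul_apply, smul_eq_mul]
    ring
  have hM : 0 ≤ M := (abs_nonneg _).trans (hfM x hx)
  have h1 : |χ x * (f y - f x - A x (y - x))| ≤ 1 * (C * ‖y - x‖ ^ 2) := by
    rw [abs_mul]
    exact mul_le_mul (hχ1 x hx) (h x hx y hy) (abs_nonneg _) zero_le_one
  have h2 : |f x * (χ y - χ x - D x (y - x))| ≤ M * (C' * ‖y - x‖ ^ 2) := by
    rw [abs_mul]
    exact mul_le_mul (hfM x hx) (hχ x hx y hy) (abs_nonneg _) hM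
  have h3 : |(χ y - χ x) * (f y - f x)| ≤ (L * ‖y - x‖) * (K * ‖y - x‖) := by
    rw [abs_mul]
    exact mul_le_mul (hL x hx y hy) (hK x hx y hy) (abs_nonneg _)
      ((abs_nonneg _).trans (hL x hx y hy))
  rw [e, Real.norm_eq_abs]
  calc _ ≤ 1 * (C * ‖y - x‖ ^ 2) + M * (C' * ‖y - x‖ ^ 2) + (L * ‖y - x‖) * (K * ‖y - x‖) :=
        (abs_add_le _ _).trans (add_le_add ((abs_add_le _ _).trans (add_le_add h1 h2)) h3)
    _ = (C + M * C' + L * K) * ‖y - x‖ ^ 2 := by ring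
    _ ≤ _ := mul_le_mul_of_nonneg_right (le_abs_self _) (sq_nonneg _)

/-- Multiplying by a bump function turns a quadratic Taylor estimate near a point into a global one;
near the center nothing changes. -/
lemma HasQuadraticTaylorOn.exists_extension [FiniteDimensional ℝ E] [HasContDiffBump E]
    {f : E → ℝ} {A : E → E →L[ℝ] ℝ} {δ M₁ M₂ K : ℝ} {c : E} (hδ : 0 < δ)
    (h : HasQuadraticTaylorOn f A (Metric.ball c δ))
    (hM₁ : ∀ x ∈ Metric.ball c δ, |f x| ≤ M₁) (hM₂ : ∀ x ∈ Metric.ball c δ, ‖A x‖ ≤ M₂)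
    (hK : ∀ x ∈ Metric.ball c δ, ∀ y ∈ Metric.ball c δ, |f y - f x| ≤ K * ‖y - x‖) :
    ∃ (g : E → ℝ) (B : E → E →L[ℝ] ℝ), HasQuadraticTaylorOn g B univ ∧ B c = A c ∧
      ∀ x ∈ Metric.ball c (δ / 3), g x = f x := by
  have hM₁0 : 0 ≤ M₁ := (abs_nonneg _).trans (hM₁ c (Metric.mem_ball_self hδ))
  have hM₂0 : 0 ≤ M₂ := (norm_nonneg _).trans (hM₂ c (Metric.mem_ball_self hδ))
  let χ : ContDiffBump c := ⟨δ / 3, δ / 2, by positivity, by linarith⟩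
  have hχ2 : ContDiff ℝ 2 χ := χ.contDiff
  have hχ := hasQuadraticTaylorOn_of_hasCompactSupport hχ2 χ.hasCompactSupport
  obtain ⟨L, hL⟩ := hχ2.lipschitzWith_of_hasCompactSupport χ.hasCompactSupport (by norm_num)
  have hfd : ∀ x, ‖fderiv ℝ χ x‖ ≤ L := fun x => norm_fderiv_le_of_lipschitz ℝ hL
  have hz : ∀ x, x ∉ Metric.closedBall c (δ / 2) → χ x = 0 ∧ fderiv ℝ χ x = 0 := by
    intro x hx
    have : x ∉ tsupport χ := by rw [χ.tsupport_eq]; exact hx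
    refine ⟨image_eq_zero_of_notMem_tsupport this, ?_⟩
    by_contra hne
    exact this (support_fderiv_subset ℝ hne)
  have hχ1 : ∀ x, |χ x| ≤ 1 := fun x => by
    rw [abs_of_nonneg χ.nonneg]; exact χ.le_one
  have hin : Metric.closedBall c (δ / 2) ⊆ Metric.ball c δ :=
    Metric.closedBall_subset_ball (by linarith)
  have hnear := (hχ.mono (subset_univ (Metric.ball c δ))).mul h (fun x _ => hχ1 x) hM₁
    (L := L) (fun x _ y _ => by
      have := hL.dist_le_mul y x
      rwa [Real.dist_eq, dist_eq_norm] at this) hK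
  have hFb : ∀ x, ‖χ x * f x‖ ≤ M₁ := by
    intro x
    by_cases hx : x ∈ Metric.closedBall c (δ / 2)
    · rw [Real.norm_eq_abs, abs_mul]
      calc _ ≤ 1 * M₁ := mul_le_mul (hχ1 x) (hM₁ x (hin hx)) (abs_nonneg _) zero_le_one
        _ = _ := one_mul _
    · simp [(hz x hx).1, hM₁0]
  have hBb : ∀ x, ‖χ x • A x + f x • fderiv ℝ χ x‖ ≤ 1 * M₂ + M₁ * L := by
    intro x
    by_cases hx : x ∈ Metric.closedBall c (δ / 2)
    · refine (norm_add_le _ _).trans (add_le_add ?_ ?_)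
      · rw [norm_smul]
        exact mul_le_mul (hχ1 x) (hM₂ x (hin hx)) (norm_nonneg _) zero_le_one
      · rw [norm_smul]
        exact mul_le_mul (hM₁ x (hin hx)) (hfd x) (norm_nonneg _) hM₁0
    · simp only [(hz x hx).1, (hz x hx).2, zero_smul, smul_zero, add_zero, norm_zero]
      positivity
  have hc : χ c = 1 := χ.one_of_mem_closedBall (Metric.mem_closedBall_self χ.rIn_pos.le)
  have hc' : fderiv ℝ χ c = 0 := by
    rw [χ.eventuallyEq_one.fderiv_eq]; simp
  refine ⟨fun x => χ x * f x, fun x => χ x • A x + f x • fderiv ℝ χ x, ?_, ?_, ?_⟩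
  · obtain ⟨C, hC, hnear⟩ := hnear
    refine ⟨C + (((M₁ + M₁) * (δ / 2)⁻¹ ^ 2 + (1 * M₂ + M₁ * L) * (δ / 2)⁻¹)), by positivity,
      fun x _ y _ => ?_⟩
    rw [add_mul]
    by_cases hg : δ / 2 ≤ ‖y - x‖
    · exact le_add_of_nonneg_of_le (by positivity)
        (norm_taylor_le_of_gap (half_pos hδ) hFb hBb hg)
    refine le_add_of_le_of_nonneg ?_ (by positivity)
    push Not at hg
    rw [← dist_eq_norm] at hg
    by_cases hx : x ∈ Metric.closedBall c (δ / 2)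
    · refine hnear x (hin hx) y ?_
      rw [Metric.mem_closedBall] at hx
      rw [Metric.mem_ball]
      linarith [dist_triangle y x c]
    by_cases hy : y ∈ Metric.closedBall c (δ / 2)
    · refine hnear x ?_ y (hin hy)
      rw [Metric.mem_closedBall] at hy
      rw [Metric.mem_ball]
      linarith [dist_triangle_left x c y]
    · beta_reduce
      rw [(hz x hx).1, (hz x hx).2, (hz y hy).1]
      simp only [zero_mul, zero_smul, smul_zero, add_zero, sub_zero, zero_apply,
        norm_zero]
      positivity
  · simp [hc, hc']
  · intro x hx
    have : χ x = 1 := χ.one_of_mem_closedBall (Metric.ball_subset_closedBall hx)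
    simp [this]

end Taylor

/-! ### Domains with two-sided tangent balls are locally regions below `C^{1,1}` graphs -/

section Graph

variable {E : Type*} [NormedAddCommGroup E] [InnerProductSpace ℝ E]

lemma coe_orthogonalProjectionOnto_span_singleton_orthogonal {e : E} (he : ‖e‖ = 1) (y : E) :
    (((Submodule.span ℝ {e})ᗮ.orthogonalProjectionOnto y : (Submodule.span ℝ {e})ᗮ) : E)
      = y - ⟪e, y⟫ • e := by
  have h := Submodule.eq_starProjection_of_mem_orthogonal (K := (Submodule.span ℝ {e})ᗮ) (u := y)
    (v := y - ⟪e, y⟫ • e) ?_ ?_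
  · rw [← h]; rfl
  · rw [Submodule.mem_orthogonal_singleton_iff_inner_right, inner_sub_right, inner_smul_right,
      real_inner_self_eq_norm_sq, he]
    ring
  · rw [sub_sub_cancel, Submodule.orthogonal_orthogonal]
    exact Submodule.smul_mem _ _ (Submodule.mem_span_singleton_self e)

lemma inner_coe_orthogonal_span_singleton {e : E} (h : (Submodule.span ℝ {e})ᗮ) :
    ⟪e, (h : E)⟫ = 0 :=
  (Submodule.mem_orthogonal_singleton_iff_inner_right).1 h.2

lemma norm_sq_add_smul_of_inner_eq_zero {e h : E} (he : ‖e‖ = 1) (hh : ⟪e, h⟫ = 0) (s : ℝ) :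
    ‖h + s • e‖ ^ 2 = ‖h‖ ^ 2 + s ^ 2 := by
  rw [norm_add_sq_real, inner_smul_right, real_inner_comm, hh, norm_smul, he, Real.norm_eq_abs,
    mul_one, sq_abs]
  ring

lemma inter_frontier_nonempty_of_isPreconnected {X : Type*} [TopologicalSpace X] {t Ω : Set X}
    (ht : IsPreconnected t) (hΩ : IsOpen Ω) (h1 : (t ∩ Ω).Nonempty) (h2 : (t ∩ Ωᶜ).Nonempty) :
    (t ∩ frontier Ω).Nonempty := by
  by_contra hne
  rw [not_nonempty_iff_eq_empty] at hne
  have hcover : t ⊆ Ω ∪ (closure Ω)ᶜ := by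
    intro x hx
    by_cases hxΩ : x ∈ Ω
    · exact Or.inl hxΩ
    · refine Or.inr fun hc => ?_
      have : x ∈ t ∩ frontier Ω := ⟨hx, hΩ.frontier_eq ▸ ⟨hc, hxΩ⟩⟩
      rw [hne] at this
      exact this
  obtain ⟨z, hz, hz'⟩ := h2
  obtain ⟨y, -, hy, hy'⟩ := ht Ω (closure Ω)ᶜ hΩ isClosed_closure.isOpen_compl hcover h1
    ⟨z, hz, (hcover hz).resolve_left hz'⟩
  exact hy' (subset_closure hy)

/-- Near `x₀` the normals make a small angle with the normal `e` at `x₀`. -/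
lemma IsBallNormal.half_le_inner {Ω : Set E} {r s : ℝ} {x₀ e h ν : E}
    (hν : IsBallNormal Ω r (x₀ + h + s • e) ν) (hr : 0 < r) (hx₀ : IsBallNormal Ω r x₀ e)
    (he : ⟪e, h⟫ = 0) (hh : ‖h‖ ≤ r / 8) (hs : |s| ≤ r / 8) : 1 / 2 ≤ ⟪e, ν⟫ := by
  have h1 := hν.norm_sub_le hr hx₀
  rw [show x₀ + h + s • e - x₀ = h + s • e by abel] at h1
  have h2 := norm_sq_add_smul_of_inner_eq_zero hx₀.1 he s
  have h3 : s ^ 2 ≤ (r / 8) ^ 2 := sq_le_sq' (abs_le.1 hs).1 (abs_le.1 hs).2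
  have h4 : ‖h‖ ^ 2 ≤ (r / 8) ^ 2 := pow_le_pow_left₀ (norm_nonneg _) hh 2
  have h5 : (r * ‖ν - e‖) ^ 2 ≤ r ^ 2 / 32 := by
    nlinarith [pow_le_pow_left₀ (by positivity) h1 2]
  have h6 := norm_sub_sq_real ν e
  rw [hν.1, hx₀.1, real_inner_comm] at h6
  have h7 : ‖ν - e‖ ^ 2 ≤ 1 / 32 := by
    rw [mul_pow] at h5
    have : 0 < r ^ 2 := by positivity
    nlinarith
  linarith

/-- The line in direction of the normal `e` at `x₀` through a nearby point crosses the boundary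
exactly once near `x₀`: it enters the interior ball at `x₀` below and the exterior ball above, and
at each crossing the normal is so close to `e` that the tangent balls there contain the remaining
parts of the segment. -/
lemma exists_unique_crossing {Ω : Set E} {r : ℝ} (hr : 0 < r) (hΩ : IsOpen Ω)
    (hb : HasTwoSidedBalls Ω r) {x₀ e : E} (hx₀ : IsBallNormal Ω r x₀ e)
    {h : E} (he : ⟪e, h⟫ = 0) (hh : ‖h‖ ≤ r / 8) :
    ∃ s ∈ Icc (-(r / 8)) (r / 8), x₀ + h + s • e ∈ frontier Ω ∧
      ∀ t ∈ Icc (-(r / 8)) (r / 8), x₀ + h + t • e ∈ Ω ↔ t < s := by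
  have hsq : ‖h‖ ^ 2 ≤ (r / 8) ^ 2 := pow_le_pow_left₀ (norm_nonneg _) hh 2
  have hin : ∀ s : ℝ, ⟪h + s • e, e⟫ = s := fun s => by
    rw [inner_add_left, real_inner_comm, he, real_inner_smul_left, real_inner_self_eq_norm_sq,
      hx₀.1]; ring
  have hlow : x₀ + h + (-(r / 8)) • e ∈ Ω := by
    apply hx₀.2.1
    rw [mem_ball_sub_smul_iff hr hx₀.1, show x₀ + h + (-(r / 8)) • e - x₀ = h + (-(r / 8)) • e by abel,
      norm_sq_add_smul_of_inner_eq_zero hx₀.1 he, hin]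
    nlinarith
  have hup : x₀ + h + (r / 8) • e ∈ Ωᶜ := by
    apply hx₀.2.2
    rw [mem_ball_add_smul_iff hr hx₀.1, show x₀ + h + (r / 8) • e - x₀ = h + (r / 8) • e by abel,
      norm_sq_add_smul_of_inner_eq_zero hx₀.1 he, hin]
    nlinarith
  have hpc : IsPreconnected ((fun s : ℝ => x₀ + h + s • e) '' Icc (-(r / 8)) (r / 8)) :=
    isPreconnected_Icc.image _ (by fun_prop)
  obtain ⟨_, ⟨s, hs, rfl⟩, hsf⟩ := inter_frontier_nonempty_of_isPreconnected hpc hΩ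
    ⟨_, ⟨-(r / 8), ⟨le_rfl, by linarith⟩, rfl⟩, hlow⟩ ⟨_, ⟨r / 8, ⟨by linarith, le_rfl⟩, rfl⟩, hup⟩
  simp only at hsf
  refine ⟨s, hs, hsf, fun t ht => ?_⟩
  obtain ⟨ν, hν⟩ := hb _ hsf
  have hνe : 1 / 2 ≤ ⟪e, ν⟫ := hν.half_le_inner hr hx₀ he hh (abs_le.2 hs)
  have hdiff : x₀ + h + t • e - (x₀ + h + s • e) = (t - s) • e := by module
  have hn : ‖(t - s) • e‖ ^ 2 = (t - s) ^ 2 := by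
    rw [norm_smul, hx₀.1, mul_one, Real.norm_eq_abs, sq_abs]
  have hts : |t - s| < r := by
    rw [abs_lt]; constructor <;> linarith [hs.1, hs.2, ht.1, ht.2]
  rw [abs_lt] at hts
  constructor
  · intro hmem
    by_contra! hle
    rcases hle.eq_or_lt with rfl | hlt
    · exact (hΩ.frontier_eq ▸ hsf).2 hmem
    · refine hν.2.2 ?_ hmem
      rw [mem_ball_add_smul_iff hr hν.1, hdiff, hn, real_inner_smul_left]
      have h1 : (t - s) * r ≤ 2 * r * ((t - s) * ⟪e, ν⟫) := by nlinarith [mul_pos hr (sub_pos.2 hlt)]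
      nlinarith
  · intro hlt
    apply hν.2.1
    rw [mem_ball_sub_smul_iff hr hν.1, hdiff, hn, real_inner_smul_left]
    have h1 : (s - t) * r ≤ 2 * r * ((s - t) * ⟪e, ν⟫) := by nlinarith [mul_pos hr (sub_pos.2 hlt)]
    nlinarith

/-- The height function given by `exists_unique_crossing` has a quadratic Taylor estimate: a
boundary point avoids both tangent balls at any other one, so it lies close to the tangent plane
there. -/
lemma exists_local_height [FiniteDimensional ℝ E] {Ω : Set E} {r : ℝ} (hr : 0 < r)
    (hΩ : IsOpen Ω) (hb : HasTwoSidedBalls Ω r) {x₀ e : E} (hx₀f : x₀ ∈ frontier Ω)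
    (hx₀ : IsBallNormal Ω r x₀ e) :
    ∃ (f : (Submodule.span ℝ {e})ᗮ → ℝ)
      (A : (Submodule.span ℝ {e})ᗮ → (Submodule.span ℝ {e})ᗮ →L[ℝ] ℝ),
      HasQuadraticTaylorOn f A univ ∧ A 0 = 0 ∧
      ∀ h ∈ Metric.ball (0 : (Submodule.span ℝ {e})ᗮ) (r / 24), ∀ t ∈ Icc (-(r / 8)) (r / 8),
        x₀ + (h : E) + t • e ∈ Ω ↔ t < f h := by
  set H := (Submodule.span ℝ {e})ᗮ with hH
  have hcross : ∀ h : H, ∃ s, ‖h‖ < r / 8 → s ∈ Icc (-(r / 8)) (r / 8) ∧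
      x₀ + (h : E) + s • e ∈ frontier Ω ∧
      ∀ t ∈ Icc (-(r / 8)) (r / 8), x₀ + (h : E) + t • e ∈ Ω ↔ t < s := by
    intro h
    by_cases hh : ‖h‖ < r / 8
    · obtain ⟨s, hs⟩ := exists_unique_crossing hr hΩ hb hx₀
        (inner_coe_orthogonal_span_singleton h) hh.le
      exact ⟨s, fun _ => hs⟩
    · exact ⟨0, fun h => absurd h hh⟩
  choose f hf using hcross
  have hnormal : ∀ h : H, ∃ ν : E, ‖h‖ < r / 8 →
      IsBallNormal Ω r (x₀ + (h : E) + f h • e) ν ∧ 1 / 2 ≤ ⟪e, ν⟫ := by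
    intro h
    by_cases hh : ‖h‖ < r / 8
    swap
    · exact ⟨0, fun h => absurd h hh⟩
    obtain ⟨hs, hsf, -⟩ := hf h hh
    obtain ⟨ν, hν⟩ := hb _ hsf
    exact ⟨ν, fun _ => ⟨hν, hν.half_le_inner hr hx₀
      (inner_coe_orthogonal_span_singleton h) hh.le (abs_le.2 hs)⟩⟩
  choose ν hν using hnormal
  set A : H → H →L[ℝ] ℝ := fun h => -(⟪e, ν h⟫⁻¹ • (innerSL ℝ (ν h)).comp H.subtypeL) with hA
  have hAapp : ∀ h k : H, A h k = -(⟪e, ν h⟫⁻¹ * ⟪ν h, (k : E)⟫) := fun h k => by simp [hA]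
  have hball : ∀ h ∈ Metric.ball (0 : H) (r / 8), ‖h‖ < r / 8 := fun h hh => by simpa using hh
  have hAb : ∀ h ∈ Metric.ball (0 : H) (r / 8), ‖A h‖ ≤ 2 := by
    intro h hh
    obtain ⟨h1, h2⟩ := hν h (hball h hh)
    refine ContinuousLinearMap.opNorm_le_bound _ (by norm_num) fun k => ?_
    rw [hAapp, norm_neg, norm_mul, norm_inv, Real.norm_of_nonneg (by linarith : 0 ≤ ⟪e, ν h⟫)]
    have h3 : ‖⟪ν h, (k : E)⟫‖ ≤ ‖k‖ := by
      have := norm_inner_le_norm (𝕜 := ℝ) (ν h) (k : E)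
      rwa [h1.1, one_mul] at this
    have h4 : ⟪e, ν h⟫⁻¹ ≤ 2 := by
      rw [inv_le_comm₀ (by linarith) (by norm_num)]; linarith
    exact mul_le_mul h4 h3 (norm_nonneg _) (by norm_num)
  have hfb : ∀ h ∈ Metric.ball (0 : H) (r / 8), |f h| ≤ r / 8 := fun h hh =>
    abs_le.2 (hf h (hball h hh)).1
  have hest : ∀ h ∈ Metric.ball (0 : H) (r / 8), ∀ k ∈ Metric.ball (0 : H) (r / 8),
      r * |f k - f h - A h (k - h)| ≤ ‖k - h‖ ^ 2 + (f k - f h) ^ 2 := by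
    intro h hh k hk
    obtain ⟨h1, h2⟩ := hν h (hball h hh)
    have h3 := h1.abs_inner_le hr hΩ (hf k (hball k hk)).2.1
    rw [show x₀ + (k : E) + f k • e - (x₀ + h + f h • e) = ((k - h : H) : E) + (f k - f h) • e by
      rw [Submodule.coe_sub]; module, norm_sq_add_smul_of_inner_eq_zero hx₀.1
      (inner_coe_orthogonal_span_singleton _), inner_add_left, real_inner_smul_left,
      real_inner_comm] at h3
    have h4 : f k - f h - A h (k - h) =
        ⟪e, ν h⟫⁻¹ * (⟪ν h, ((k - h : H) : E)⟫ + (f k - f h) * ⟪e, ν h⟫) := by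
      rw [hAapp]
      have : ⟪e, ν h⟫ ≠ 0 := by linarith
      field_simp
      ring
    rw [h4, abs_mul, abs_inv, abs_of_nonneg (by linarith : 0 ≤ ⟪e, ν h⟫)]
    have h5 : ⟪e, ν h⟫⁻¹ ≤ 2 := by
      rw [inv_le_comm₀ (by linarith) (by norm_num)]; linarith
    rw [Submodule.coe_norm]
    refine le_trans ?_ h3
    rw [mul_comm 2 r, mul_assoc]
    gcongr
  have hLip : ∀ h ∈ Metric.ball (0 : H) (r / 8), ∀ k ∈ Metric.ball (0 : H) (r / 8),
      |f k - f h| ≤ 3 * ‖k - h‖ := by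
    intro h hh k hk
    have h1 := hest h hh k hk
    have h2 : |A h (k - h)| ≤ 2 * ‖k - h‖ :=
      ((A h).le_opNorm _).trans (mul_le_mul_of_nonneg_right (hAb h hh) (norm_nonneg _))
    have h3 : |f k - f h| ≤ |f k - f h - A h (k - h)| + |A h (k - h)| := by
      simpa using abs_add_le (f k - f h - A h (k - h)) (A h (k - h))
    have h4 : |f k - f h| ≤ r / 4 := by
      have := hfb h hh; have := hfb k hk; have := abs_sub (f k) (f h); linarith
    have h5 : ‖k - h‖ ≤ r / 4 := by
      have := hball h hh; have := hball k hk; have := norm_sub_le k h; linarith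
    rw [← sq_abs (f k - f h)] at h1
    have h6 : ‖k - h‖ ^ 2 ≤ r * (‖k - h‖ / 4) := by nlinarith [norm_nonneg (k - h)]
    have h7 : |f k - f h| ^ 2 ≤ r * (|f k - f h| / 4) := by nlinarith [abs_nonneg (f k - f h)]
    have h8 : |f k - f h - A h (k - h)| ≤ ‖k - h‖ / 4 + |f k - f h| / 4 :=
      le_of_mul_le_mul_left (by linarith) hr
    linarith
  have hT : HasQuadraticTaylorOn f A (Metric.ball (0 : H) (r / 8)) := by
    refine ⟨10 / r, by positivity, fun h hh k hk => ?_⟩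
    have h1 := hest h hh k hk
    have h2 := hLip h hh k hk
    rw [Real.norm_eq_abs, div_mul_eq_mul_div, le_div_iff₀ hr, mul_comm]
    have h3 := pow_le_pow_left₀ (abs_nonneg _) h2 2
    rw [sq_abs] at h3
    nlinarith
  have hf0 : f 0 = 0 := by
    obtain ⟨h1, h2, h3⟩ := hf 0 (by simpa using hr)
    have h4 := h3 0 ⟨by linarith, by linarith⟩
    simp only [ZeroMemClass.coe_zero, add_zero, zero_smul] at h4 h2
    have h5 : x₀ ∉ Ω := (hΩ.frontier_eq ▸ hx₀f).2
    refine le_antisymm (not_lt.1 fun h => h5 (h4.2 h)) (not_lt.1 fun hlt => ?_)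
    refine (hΩ.frontier_eq ▸ h2).2 (hx₀.2.1 ?_)
    rw [mem_ball_sub_smul_iff hr hx₀.1, add_sub_cancel_left, norm_smul, real_inner_smul_left,
      real_inner_self_eq_norm_sq, hx₀.1, Real.norm_eq_abs, mul_one, sq_abs]
    nlinarith [h1.1]
  have hA0 : A 0 = 0 := by
    have h1 := (hν 0 (by simpa using hr)).1.norm_sub_le hr hx₀
    rw [hf0] at h1
    simp only [ZeroMemClass.coe_zero, add_zero, zero_smul, sub_self, norm_zero] at h1
    have h2 : ν 0 = e := by
      rw [← sub_eq_zero, ← norm_eq_zero]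
      nlinarith [norm_nonneg (ν 0 - e)]
    ext k
    rw [hAapp, h2, inner_coe_orthogonal_span_singleton]
    simp
  obtain ⟨g, B, hgB, hB0, hg⟩ := hT.exists_extension (by positivity) hfb hAb hLip
  refine ⟨g, B, hgB, hB0.trans hA0, fun h hh t ht => ?_⟩
  rw [show r / 8 / 3 = r / 24 by ring] at hg
  rw [hg h hh]
  refine (hf h ?_).2.2 t ht
  rw [mem_ball_zero_iff] at hh
  linarith

end Graph

section Euclidean

variable {N : ℕ} {Ω : Set (EuclideanSpace ℝ (Fin N))} {r : ℝ}

lemma exists_isC11Graph (hr : 0 < r) (hΩ : IsOpen Ω) (hb : HasTwoSidedBalls Ω r)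
    {x e : EuclideanSpace ℝ (Fin N)} (hx : x ∈ frontier Ω) (he : IsBallNormal Ω r x e) :
    ∃ (ρ : ℝ) (φ : (Submodule.span ℝ {e})ᗮ → ℝ), IsC11Graph Ω x ρ e φ ∧
      gradient φ ((Submodule.span ℝ {e})ᗮ.orthogonalProjectionOnto x) = 0 := by
  obtain ⟨f, A, hfA, hA0, hf⟩ := exists_local_height hr hΩ hb hx he
  set P := (Submodule.span ℝ {e})ᗮ.orthogonalProjectionOnto with hP
  have hT : HasQuadraticTaylorOn (fun p => ⟪e, x⟫ + f (p - P x)) (fun p => A (p - P x)) univ := by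
    obtain ⟨C, hC, h⟩ := hfA
    refine ⟨C, hC, fun p _ q _ => ?_⟩
    have := h (p - P x) trivial (q - P x) trivial
    rw [sub_sub_sub_cancel_right] at this
    simpa only [add_sub_add_left_eq_sub] using this
  refine ⟨r / 24, fun p => ⟪e, x⟫ + f (p - P x), ⟨by positivity, he.1, hT.contDiff, ?_, ?_⟩, ?_⟩
  · rw [hT.fderiv_eq]; exact hT.exists_lipschitzWith
  · ext y
    rw [mem_inter_iff, and_comm, mem_sep_iff, and_congr_right_iff]
    intro hy
    rw [mem_ball_iff_norm] at hy
    have h1 : y = x + ((P (y - x) : (Submodule.span ℝ {e})ᗮ) : EuclideanSpace ℝ (Fin N))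
        + ⟪e, y - x⟫ • e := by
      rw [hP, coe_orthogonalProjectionOnto_span_singleton_orthogonal he.1]; abel
    have h2 : ‖P (y - x)‖ < r / 24 :=
      ((Submodule.norm_orthogonalProjectionOnto_apply_le _ _)).trans_lt hy
    have h3 : |⟪e, y - x⟫| ≤ r / 8 := by
      have := abs_real_inner_le_norm e (y - x)
      rw [he.1, one_mul] at this
      linarith
    have h4 := hf (P (y - x)) (by simpa using h2) _ (abs_le.1 h3)
    rw [← h1] at h4
    rw [h4, inner_sub_right, map_sub, sub_lt_iff_lt_add']
  · rw [gradient, hT.fderiv_eq]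
    simp [hA0]

lemma HasTwoSidedBalls.hasC11Boundary (hr : 0 < r) (hΩ : IsOpen Ω) (hb : HasTwoSidedBalls Ω r) :
    HasC11Boundary Ω := fun x hx => by
  obtain ⟨e, he⟩ := hb x hx
  obtain ⟨ρ, φ, h, -⟩ := exists_isC11Graph hr hΩ hb hx he
  exact ⟨ρ, e, φ, h⟩

lemma IsBallNormal.isOutwardNormal (hr : 0 < r) (hΩ : IsOpen Ω) (hb : HasTwoSidedBalls Ω r)
    {x e : EuclideanSpace ℝ (Fin N)} (hx : x ∈ frontier Ω) (he : IsBallNormal Ω r x e) :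
    IsOutwardNormal Ω x e := by
  obtain ⟨ρ, φ, h, hg⟩ := exists_isC11Graph hr hΩ hb hx he
  refine ⟨ρ, e, φ, h, e, ?_, ?_⟩
  · rw [hg]; simp
  · rw [he.1]; simp

lemma HasTwoSidedBalls.mem_subC (hr : 0 < r) (hne : Ω.Nonempty) (hΩ : IsOpen Ω)
    (hbd : Bornology.IsBounded Ω) (hb : HasTwoSidedBalls Ω r) : Ω ∈ SubC N :=
  ⟨hne, hΩ, hbd, hb.hasC11Boundary hr hΩ⟩

lemma hasTwoSidedBalls_of_mem_sBall (hr : 0 < r) (h : Ω ∈ SBall N r) : HasTwoSidedBalls Ω r := by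
  obtain ⟨-, R, hR, hi, ho⟩ := h
  intro x hx
  obtain ⟨y, ρ, hρ, hy, hxy⟩ := hi x hx
  obtain ⟨z, σ, hσ, hz, hxz⟩ := ho x hx
  exact (exists_isBallNormal_of_mem_sphere hr (hR.trans hρ) (hR.trans hσ) hy
    (Metric.ball_subset_closedBall.trans hz) hxy hxz).imp fun _ h => h.1

lemma HasTwoSidedBalls.mem_sBall (hr : 0 < r) (hne : Ω.Nonempty) (hΩ : IsOpen Ω)
    (hbd : Bornology.IsBounded Ω) (hb : HasTwoSidedBalls Ω r) : Ω ∈ SBall N r := by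
  refine ⟨hb.mem_subC hr hne hΩ hbd, r, le_rfl, fun x hx => ?_, fun x hx => ?_⟩
  · obtain ⟨ν, hν⟩ := hb x hx
    exact ⟨_, r, le_rfl, hν.2.1, mem_sphere_sub_smul hr hν.1⟩
  · obtain ⟨ν, hν⟩ := hb x hx
    exact ⟨_, r, le_rfl, hν.closedBall_subset_compl hr hΩ, mem_sphere_add_smul hr hν.1⟩

lemma mem_sBall_iff (hr : 0 < r) : Ω ∈ SBall N r ↔
    Ω.Nonempty ∧ IsOpen Ω ∧ Bornology.IsBounded Ω ∧ HasTwoSidedBalls Ω r :=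
  ⟨fun h => ⟨h.1.1, h.1.2.1, h.1.2.2.1, hasTwoSidedBalls_of_mem_sBall hr h⟩,
    fun h => h.2.2.2.mem_sBall hr h.1 h.2.1 h.2.2.1⟩

end Euclidean

/-! ### Global flows of bounded Lipschitz vector fields -/

section Flow

variable {E : Type*} [NormedAddCommGroup E] [NormedSpace ℝ E] {X : E → E} {K : NNReal} {M : ℝ}
  {ψ : ℝ → E → E}

/-- `ψ` is the global flow of `X`; this is `IsGlobalFlow` in an arbitrary normed space. -/
def IsFlow (X : E → E) (ψ : ℝ → E → E) : Prop :=
  ∀ x, ψ 0 x = x ∧ ∀ t, HasDerivAt (fun s => ψ s x) (X (ψ t x)) t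

/-- For a bounded field the Picard–Lindelöf theorem gives solutions on each interval `[-T, T]`;
by uniqueness they fit together. -/
lemma exists_globalFlow [CompleteSpace E] (hX : LipschitzWith K X) (hM : ∀ x, ‖X x‖ ≤ M) :
    ∃ ψ, IsFlow X ψ := by
  have hM0 : 0 ≤ M := (norm_nonneg _).trans (hM 0)
  have hloc : ∀ (x : E) (T : ℝ), ∃ γ : ℝ → E, 0 < T → γ 0 = x ∧
      ∀ t ∈ Ioo (-T) T, HasDerivAt γ (X (γ t)) t := by
    intro x T
    by_cases hT : 0 < T
    swap
    · exact ⟨fun _ => 0, fun h => absurd h hT⟩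
    have hpl : IsPicardLindelof (fun _ : ℝ => X) (tmin := -T) (tmax := T)
        ⟨0, by linarith, hT.le⟩ x ⟨M * T, by positivity⟩ 0 ⟨M, hM0⟩ K :=
      .of_time_independent (fun y _ => hM y) hX.lipschitzOnWith (by
        simp only [sub_zero, sub_neg_eq_add, zero_add, max_self, NNReal.coe_zero]; exact le_rfl)
    obtain ⟨γ, h0, h⟩ := hpl.exists_eq_forall_mem_Icc_hasDerivWithinAt (x := x) (by simp)
    exact ⟨γ, fun _ => ⟨h0, fun t ht => (h t (Ioo_subset_Icc_self ht)).hasDerivAt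
      (Icc_mem_nhds ht.1 ht.2)⟩⟩
  choose γ hγ using hloc
  have heq : ∀ x T T', 0 < T → T ≤ T' → EqOn (γ x T) (γ x T') (Ioo (-T) T) := by
    intro x T T' hT hTT'
    obtain ⟨h0, h⟩ := hγ x T hT
    obtain ⟨h0', h'⟩ := hγ x T' (hT.trans_le hTT')
    exact ODE_solution_unique_of_mem_Ioo (v := fun _ => X) (s := fun _ => univ) (K := K)
      (fun _ _ => hX.lipschitzOnWith) (t₀ := 0) ⟨by linarith, hT⟩
      (fun t ht => ⟨h t ht, trivial⟩)
      (fun t ht => ⟨h' t ⟨by linarith [ht.1], by linarith [ht.2]⟩, trivial⟩) (h0.trans h0'.symm)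
  refine ⟨fun t x => γ x (|t| + 1) t, fun x => ⟨(hγ x _ (by positivity)).1, fun t => ?_⟩⟩
  have ht : t ∈ Ioo (-(|t| + 1)) (|t| + 1) := by
    constructor <;> linarith [neg_abs_le t, le_abs_self t]
  have ht2 : t ∈ Ioo (-(|t| + 2)) (|t| + 2) := by
    constructor <;> linarith [neg_abs_le t, le_abs_self t]
  have h1 := (hγ x (|t| + 2) (by positivity)).2 t ht2
  beta_reduce
  rw [heq x (|t| + 1) (|t| + 2) (by positivity) (by linarith) ht]
  refine h1.congr_of_eventuallyEq ?_
  filter_upwards [Ioo_mem_nhds ht.1 ht.2] with s hs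
  have hs1 : |s| < |t| + 1 := abs_lt.2 hs
  exact heq x (|s| + 1) (|t| + 2) (by positivity) (by linarith)
    ⟨by linarith [neg_abs_le s], by linarith [le_abs_self s]⟩

lemma IsFlow.unique (hψ : IsFlow X ψ) (hX : LipschitzWith K X) {γ : ℝ → E}
    (hγ : ∀ t, HasDerivAt γ (X (γ t)) t) (t : ℝ) : γ t = ψ t (γ 0) :=
  congrFun (ODE_solution_unique_univ (v := fun _ => X) (s := fun _ => univ) (K := K) (t₀ := 0)
    (g := fun s => ψ s (γ 0)) (fun _ => hX.lipschitzOnWith) (fun t => ⟨hγ t, trivial⟩)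
    (fun t => ⟨(hψ _).2 t, trivial⟩) (hψ _).1.symm) t

lemma IsFlow.apply_apply (hψ : IsFlow X ψ) (hX : LipschitzWith K X) (s t : ℝ) (x : E) :
    ψ s (ψ t x) = ψ (s + t) x := by
  have h := hψ.unique hX (γ := fun s => ψ (s + t) x) (fun s => by
    simpa using ((hψ x).2 (s + t)).comp_add_const s t) s
  simpa using h.symm

lemma IsFlow.apply_neg_apply (hψ : IsFlow X ψ) (hX : LipschitzWith K X) (t : ℝ) (x : E) :
    ψ t (ψ (-t) x) = x := by
  rw [hψ.apply_apply hX, add_neg_cancel, (hψ x).1]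

lemma IsFlow.neg_apply_apply (hψ : IsFlow X ψ) (hX : LipschitzWith K X) (t : ℝ) (x : E) :
    ψ (-t) (ψ t x) = x := by
  rw [hψ.apply_apply hX, neg_add_cancel, (hψ x).1]

lemma IsFlow.neg (hψ : IsFlow X ψ) : IsFlow (fun x => -X x) (fun t => ψ (-t)) := fun x =>
  ⟨by simpa using (hψ x).1, fun t => by
    have := ((hψ x).2 (-t)).scomp t (hasDerivAt_neg t)
    rw [neg_one_smul] at this
    exact this⟩

lemma IsFlow.continuous_left (hψ : IsFlow X ψ) (x : E) : Continuous fun t => ψ t x :=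
  continuous_iff_continuousAt.2 fun t => ((hψ x).2 t).continuousAt

lemma IsFlow.continuous_of_nonneg (hψ : IsFlow X ψ) (hX : LipschitzWith K X) {t : ℝ}
    (ht : 0 ≤ t) : Continuous (ψ t) := by
  refine (LipschitzWith.of_dist_le_mul (K := ⟨Real.exp (K * t), (Real.exp_pos _).le⟩)
    fun x y => ?_).continuous
  have := dist_le_of_trajectories_ODE (v := fun _ => X) (a := 0) (b := t) (fun _ => hX)
    (hψ.continuous_left x).continuousOn
    (fun s _ => ((hψ x).2 s).hasDerivWithinAt) (hψ.continuous_left y).continuousOn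
    (fun s _ => ((hψ y).2 s).hasDerivWithinAt) le_rfl t ⟨ht, le_rfl⟩
  simp only [(hψ _).1, sub_zero] at this
  rw [mul_comm]
  exact this

lemma IsFlow.continuous (hψ : IsFlow X ψ) (hX : LipschitzWith K X) (t : ℝ) :
    Continuous (ψ t) := by
  rcases le_total 0 t with ht | ht
  · exact hψ.continuous_of_nonneg hX ht
  · simpa using hψ.neg.continuous_of_nonneg hX.neg (neg_nonneg.2 ht)

/-- The time-`t` map of a flow as a homeomorphism. -/
def IsFlow.homeomorph (hψ : IsFlow X ψ) (hX : LipschitzWith K X) (t : ℝ) : E ≃ₜ E where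
  toFun := ψ t
  invFun := ψ (-t)
  left_inv := hψ.neg_apply_apply hX t
  right_inv := hψ.apply_neg_apply hX t
  continuous_toFun := hψ.continuous hX t
  continuous_invFun := hψ.continuous hX (-t)

lemma IsFlow.norm_sub_le (hψ : IsFlow X ψ) (hM : ∀ x, ‖X x‖ ≤ M) (t : ℝ) (x : E) :
    ‖ψ t x - x‖ ≤ M * |t| := by
  have := convex_univ.norm_image_sub_le_of_norm_hasDerivWithin_le (f := fun s => ψ s x)
    (x := 0) (y := t) (fun s _ => ((hψ x).2 s).hasDerivWithinAt) (fun s _ => hM _) trivial trivial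
  simpa [(hψ x).1] using this

lemma IsFlow.norm_sub_sub_smul_le (hψ : IsFlow X ψ) (hX : LipschitzWith K X)
    (hM : ∀ x, ‖X x‖ ≤ M) (t : ℝ) (x : E) :
    ‖ψ t x - x - t • X x‖ ≤ K * M * t ^ 2 := by
  have hM0 : 0 ≤ M := (norm_nonneg _).trans (hM 0)
  have := (convex_Icc (-|t|) |t|).norm_image_sub_le_of_norm_hasDerivWithin_le
    (f := fun s => ψ s x - s • X x) (f' := fun s => X (ψ s x) - X x) (C := K * M * |t|)
    (x := 0) (y := t)
    (fun s _ => (((hψ x).2 s).sub ((hasDerivAt_id s).smul_const (X x))).hasDerivWithinAt.congr_deriv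
      (by simp)) (fun s hs => ?_) ⟨by simp, by simp⟩ ⟨neg_abs_le t, le_abs_self t⟩
  · simp only [(hψ x).1, zero_smul, sub_zero, Real.norm_eq_abs] at this
    calc _ = ‖ψ t x - t • X x - x‖ := by congr 1; abel
      _ ≤ _ := this
      _ = K * M * |t| ^ 2 := by ring
      _ = _ := by rw [sq_abs]
  · have h1 := hX.dist_le_mul (ψ s x) x
    rw [dist_eq_norm, dist_eq_norm] at h1
    calc _ ≤ _ := h1
      _ ≤ K * (M * |s|) := by gcongr; exact hψ.norm_sub_le hM s x
      _ ≤ K * (M * |t|) := mul_le_mul_of_nonneg_left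
          (mul_le_mul_of_nonneg_left (abs_le.2 hs) hM0) K.2
      _ = _ := by ring

end Flow

/-! ### Images of domains under flows -/

section TransportBalls

variable {E : Type*} [NormedAddCommGroup E] [InnerProductSpace ℝ E]
  {X : E → E} {ψ : ℝ → E → E}

/-- Conormals are transported along the flow by the linear equation `m' = -(DX)ᵀ m`. For short
times, a solution is the second component of the flow of the field `(q, m) ↦ (X q, -(DX q)ᵀ m)`,
which is cut off for large `m` to make it bounded and Lipschitz. -/
lemma exists_adjoint_curve [FiniteDimensional ℝ E] (hX : ContDiff ℝ 2 X) (hc : HasCompactSupport X) :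
    ∃ s₀ > 0, ∀ ψ, IsFlow X ψ → ∀ x ν : E, ‖ν‖ = 1 → ∃ m : ℝ → E, m 0 = ν ∧
      ∀ t, |t| ≤ s₀ → 1 / 2 ≤ ‖m t‖ ∧ ‖m t‖ ≤ 3 / 2 ∧
        HasDerivAt m (-(ContinuousLinearMap.adjoint (fderiv ℝ X (ψ t x)) (m t))) t := by
  obtain ⟨K, hK⟩ := hX.lipschitzWith_of_hasCompactSupport hc (by norm_num)
  have h1 : ContDiff ℝ 1 (fderiv ℝ X) := hX.fderiv_right (by norm_num)
  obtain ⟨L, hL⟩ := h1.lipschitzWith_of_hasCompactSupport (hc.fderiv ℝ) one_ne_zero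
  obtain ⟨M, hM⟩ := hX.continuous.bounded_above_of_compact_support hc
  have hM0 : 0 ≤ M := (norm_nonneg _).trans (hM 0)
  let χ : ContDiffBump (0 : E) := ⟨2, 3, by norm_num, by norm_num⟩
  set η : E → E := fun m => χ m • m with hη
  have hη1 : ContDiff ℝ 1 η := χ.contDiff.smul contDiff_id
  have hηc : HasCompactSupport η := χ.hasCompactSupport.smul_right
  obtain ⟨R, hR⟩ := hη1.lipschitzWith_of_hasCompactSupport hηc one_ne_zero
  have hη3 : ∀ m, ‖η m‖ ≤ 3 := by
    intro m
    by_cases hm : ‖m‖ < 3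
    · rw [hη, norm_smul, Real.norm_of_nonneg χ.nonneg]
      exact (mul_le_mul χ.le_one hm.le (norm_nonneg _) zero_le_one).trans (one_mul _).le
    · have : χ m = 0 := χ.zero_of_le_dist (by simpa using not_lt.1 hm)
      simp [hη, this]
  have hη2 : ∀ m, ‖m‖ ≤ 2 → η m = m := by
    intro m hm
    have : χ m = 1 := χ.one_of_mem_closedBall (by simpa using hm)
    simp [hη, this]
  set B : E → E →L[ℝ] E := fun q => ContinuousLinearMap.adjoint (fderiv ℝ X q) with hB
  have hBK : ∀ q, ‖B q‖ ≤ K := fun q => by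
    rw [hB, LinearIsometryEquiv.norm_map]
    exact norm_fderiv_le_of_lipschitz ℝ hK
  have hBL : ∀ q q', ‖B q - B q'‖ ≤ L * ‖q - q'‖ := fun q q' => by
    rw [hB, ← map_sub, LinearIsometryEquiv.norm_map, ← dist_eq_norm, ← dist_eq_norm]
    exact hL.dist_le_mul q q'
  set Y : E × E → E × E := fun p => (X p.1, -(B p.1 (η p.2))) with hY
  have hY2 : ∀ p, ‖(Y p).2‖ ≤ K * 3 := fun p => by
    rw [hY, norm_neg]
    exact ((B p.1).le_opNorm _).trans (mul_le_mul (hBK _) (hη3 _) (norm_nonneg _) K.2)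
  have hYM : ∀ p, ‖Y p‖ ≤ max M (K * 3) := fun p => max_le_max (hM _) (hY2 p)
  have hYL : LipschitzWith (K + (L * 3 + K * R)) Y := by
    refine LipschitzWith.of_dist_le_mul fun p p' => ?_
    have hp1 : ‖p.1 - p'.1‖ ≤ dist p p' := by
      rw [← dist_eq_norm]; exact le_max_left _ _
    have hp2 : ‖p.2 - p'.2‖ ≤ dist p p' := by
      rw [← dist_eq_norm]; exact le_max_right _ _
    push_cast
    refine max_le ?_ ?_
    · have h2 : dist (Y p).1 (Y p').1 ≤ K * dist p p' := by
        refine (hK.dist_le_mul _ _).trans (mul_le_mul_of_nonneg_left ?_ K.2)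
        rwa [dist_eq_norm]
      refine h2.trans ?_
      have : 0 ≤ ((L : ℝ) * 3 + K * R) * dist p p' := by positivity
      rw [add_mul]; linarith
    · rw [dist_eq_norm]
      have e : (Y p).2 - (Y p').2 = (B p'.1 - B p.1) (η p.2) + B p'.1 (η p'.2 - η p.2) := by
        simp only [hY, sub_apply, map_sub]; abel
      have h2 : ‖(B p'.1 - B p.1) (η p.2)‖ ≤ (L * dist p p') * 3 := by
        refine (ContinuousLinearMap.le_opNorm _ _).trans
          (mul_le_mul ((hBL _ _).trans ?_) (hη3 _) (norm_nonneg _) (by positivity))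
        rw [norm_sub_rev]; gcongr
      have h3 : ‖B p'.1 (η p'.2 - η p.2)‖ ≤ K * (R * dist p p') := by
        refine (ContinuousLinearMap.le_opNorm _ _).trans
          (mul_le_mul (hBK _) ?_ (norm_nonneg _) K.2)
        have := hR.dist_le_mul p'.2 p.2
        rw [dist_eq_norm, dist_eq_norm, norm_sub_rev p'.2] at this
        exact this.trans (by gcongr)
      rw [e]
      refine (norm_add_le _ _).trans ((add_le_add h2 h3).trans ?_)
      have : 0 ≤ (K : ℝ) * dist p p' := by positivity
      linarith
  obtain ⟨Ψ, hΨ⟩ := exists_globalFlow hYL hYM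
  refine ⟨1 / (2 * (K * 3 + 1)), by positivity, fun ψ hψ x ν hν => ?_⟩
  have hd1 : ∀ t, HasDerivAt (fun s => (Ψ s (x, ν)).1) (X (Ψ t (x, ν)).1) t := fun t =>
    ((hΨ (x, ν)).2 t).fst
  have hd2 : ∀ t, HasDerivAt (fun s => (Ψ s (x, ν)).2) (Y (Ψ t (x, ν))).2 t := fun t =>
    ((hΨ (x, ν)).2 t).snd
  have h01 : (Ψ 0 (x, ν)).1 = x := by rw [(hΨ _).1]
  have h02 : (Ψ 0 (x, ν)).2 = ν := by rw [(hΨ _).1]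
  refine ⟨fun s => (Ψ s (x, ν)).2, h02, fun t ht => ?_⟩
  have hq : (Ψ t (x, ν)).1 = ψ t x := by
    have := hψ.unique hK hd1 t
    rwa [h01] at this
  have hm : ‖(Ψ t (x, ν)).2 - ν‖ ≤ 1 / 2 := by
    have := convex_univ.norm_image_sub_le_of_norm_hasDerivWithin_le
      (f := fun s => (Ψ s (x, ν)).2) (x := 0) (y := t)
      (fun s _ => (hd2 s).hasDerivWithinAt) (fun s _ => hY2 _) trivial trivial
    simp only [h02, sub_zero, Real.norm_eq_abs] at this
    rw [le_div_iff₀ (by positivity)] at ht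
    nlinarith [abs_nonneg t]
  have hm1 : 1 / 2 ≤ ‖(Ψ t (x, ν)).2‖ := by
    have := norm_sub_norm_le ν (Ψ t (x, ν)).2
    rw [norm_sub_rev, hν] at this; linarith
  have hm2 : ‖(Ψ t (x, ν)).2‖ ≤ 3 / 2 := by
    have := norm_sub_norm_le (Ψ t (x, ν)).2 ν
    rw [hν] at this; linarith
  refine ⟨hm1, hm2, ?_⟩
  have := hd2 t
  rwa [show (Y (Ψ t (x, ν))).2 = -(ContinuousLinearMap.adjoint (fderiv ℝ X (ψ t x))
    (Ψ t (x, ν)).2) by simp only [hY, hB, hq]; rw [hη2 _ (by linarith)]] at this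

/-- A point outside a ball that touches the trajectory of `x` stays outside a moving ball whose axis
is the transported conormal `m`: the function `k exp (c t) |w|² + ⟨w, m⟩`, with `w` the difference
of the trajectories, is nondecreasing, because the first-order terms in `w` of the derivative of
`⟨w, m⟩` cancel. -/
lemma inner_add_sq_nonneg_of_flow [FiniteDimensional ℝ E] {K : NNReal} {C k s₀ : ℝ}
    (hK : LipschitzWith K X)
    (hC0 : 0 ≤ C) (hk : 0 < k)
    (hC : ∀ x y, ‖X y - X x - fderiv ℝ X x (y - x)‖ ≤ C * ‖y - x‖ ^ 2) (hψ : IsFlow X ψ)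
    {x z : E} {m : ℝ → E} (hm : ∀ t ∈ Icc 0 s₀, ‖m t‖ ≤ 3 / 2 ∧
      HasDerivAt m (-(ContinuousLinearMap.adjoint (fderiv ℝ X (ψ t x)) (m t))) t)
    (h0 : 0 ≤ k * ‖z - x‖ ^ 2 + ⟪z - x, m 0⟫) {t : ℝ} (ht : t ∈ Icc 0 s₀) :
    0 ≤ k * Real.exp ((2 * K + 3 / 2 * C / k) * s₀) * ‖ψ t z - ψ t x‖ ^ 2
      + ⟪ψ t z - ψ t x, m t⟫ := by
  set c : ℝ := 2 * K + 3 / 2 * C / k with hc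
  have hc0 : 0 ≤ c := by positivity
  set w : ℝ → E := fun s => ψ s z - ψ s x with hw
  have hwd : ∀ s, HasDerivAt w (X (ψ s z) - X (ψ s x)) s := fun s =>
    ((hψ z).2 s).sub ((hψ x).2 s)
  set h : ℝ → ℝ := fun s => k * Real.exp (c * s) * ‖w s‖ ^ 2 + ⟪w s, m s⟫ with hh
  have hexp : ∀ s, HasDerivAt (fun s => k * Real.exp (c * s)) (k * Real.exp (c * s) * c) s := by
    intro s
    have := (((hasDerivAt_id s).const_mul c).exp).const_mul k
    simpa [mul_assoc] using this
  have hd : ∀ s ∈ Icc 0 s₀, HasDerivAt h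
      (k * Real.exp (c * s) * c * ‖w s‖ ^ 2
        + k * Real.exp (c * s) * (2 * ⟪w s, X (ψ s z) - X (ψ s x)⟫)
        + (⟪w s, -(ContinuousLinearMap.adjoint (fderiv ℝ X (ψ s x)) (m s))⟫
          + ⟪X (ψ s z) - X (ψ s x), m s⟫)) s := fun s hs =>
    ((hexp s).mul (hwd s).norm_sq).add ((hwd s).inner ℝ (hm s hs).2)
  have hmono : MonotoneOn h (Icc 0 s₀) := by
    refine monotoneOn_of_hasDerivWithinAt_nonneg (convex_Icc _ _)
      (fun s hs => (hd s hs).continuousAt.continuousWithinAt)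
      (fun s hs => (hd s (interior_subset hs)).hasDerivWithinAt) fun s hs => ?_
    have hs' := interior_subset hs
    have h1 : ⟪w s, -(ContinuousLinearMap.adjoint (fderiv ℝ X (ψ s x)) (m s))⟫
          + ⟪X (ψ s z) - X (ψ s x), m s⟫
        = ⟪X (ψ s z) - X (ψ s x) - fderiv ℝ X (ψ s x) (w s), m s⟫ := by
      rw [inner_neg_right, ContinuousLinearMap.adjoint_inner_right,
        inner_sub_left (X (ψ s z) - X (ψ s x))]; ring
    have h2 : |⟪X (ψ s z) - X (ψ s x) - fderiv ℝ X (ψ s x) (w s), m s⟫|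
        ≤ C * ‖w s‖ ^ 2 * (3 / 2) :=
      (abs_real_inner_le_norm _ _).trans
        (mul_le_mul (hC _ _) (hm s hs').1 (norm_nonneg _) (by positivity))
    have h3 : |⟪w s, X (ψ s z) - X (ψ s x)⟫| ≤ ‖w s‖ * (K * ‖w s‖) := by
      refine (abs_real_inner_le_norm _ _).trans (mul_le_mul_of_nonneg_left ?_ (norm_nonneg _))
      rw [← dist_eq_norm, hw, ← dist_eq_norm]
      exact hK.dist_le_mul _ _
    have h4 : 1 ≤ Real.exp (c * s) := Real.one_le_exp (mul_nonneg hc0 hs'.1)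
    rw [h1]
    have h5 := neg_abs_le ⟪X (ψ s z) - X (ψ s x) - fderiv ℝ X (ψ s x) (w s), m s⟫
    have h6 := neg_abs_le ⟪w s, X (ψ s z) - X (ψ s x)⟫
    have h7 : k * Real.exp (c * s) * (-(2 * (K * ‖w s‖ ^ 2)))
        ≤ k * Real.exp (c * s) * (2 * ⟪w s, X (ψ s z) - X (ψ s x)⟫) := by
      gcongr; nlinarith
    have h8 : k * Real.exp (c * s) * c * ‖w s‖ ^ 2 = k * Real.exp (c * s) * (2 * (K * ‖w s‖ ^ 2))
        + Real.exp (c * s) * (3 / 2 * C * ‖w s‖ ^ 2) := by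
      rw [hc]; field_simp
    have h9 : 1 * (3 / 2 * C * ‖w s‖ ^ 2) ≤ Real.exp (c * s) * (3 / 2 * C * ‖w s‖ ^ 2) := by
      gcongr
    linarith
  have hle := hmono ⟨le_rfl, ht.1.trans ht.2⟩ ht ht.1
  have h00 : h 0 = k * ‖z - x‖ ^ 2 + ⟪z - x, m 0⟫ := by
    simp [hh, hw, (hψ _).1]
  rw [h00] at hle
  refine (h0.trans hle).trans (add_le_add_left ?_ _)
  have : Real.exp (c * t) ≤ Real.exp (c * s₀) :=
    Real.exp_le_exp.2 (mul_le_mul_of_nonneg_left ht.2 hc0)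
  gcongr

/-- For short times a flow maps the outside of a ball touching `x` to the outside of a ball, of a
uniform smaller radius, touching the image of `x`; and it keeps the two balls on the two sides of `x`
opposite to each other. -/
lemma exists_flow_tangent_balls [FiniteDimensional ℝ E] (hX : ContDiff ℝ 2 X)
    (hc : HasCompactSupport X) {r : ℝ} (hr : 0 < r) :
    ∃ s₀ > 0, ∃ r' > 0, ∀ ψ, IsFlow X ψ → ∀ x ν : E, ‖ν‖ = 1 → ∀ t ∈ Icc 0 s₀, ∃ ν' : E,
      ‖ν'‖ = 1 ∧ ∀ z,
        (z ∉ Metric.ball (x - r • ν) r → ψ t z ∉ Metric.ball (ψ t x - r' • ν') r') ∧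
        (z ∉ Metric.ball (x + r • ν) r → ψ t z ∉ Metric.ball (ψ t x + r' • ν') r') := by
  obtain ⟨K, hK⟩ := hX.lipschitzWith_of_hasCompactSupport hc (by norm_num)
  obtain ⟨C, hC0, hC⟩ := hasQuadraticTaylorOn_of_hasCompactSupport hX hc
  obtain ⟨s₀, hs₀, hm⟩ := exists_adjoint_curve hX hc
  set k : ℝ := 1 / (2 * r) with hk
  have hk0 : 0 < k := by positivity
  set k' : ℝ := k * Real.exp ((2 * K + 3 / 2 * C / k) * s₀) with hk'
  have hk'0 : 0 < k' := by positivity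
  refine ⟨s₀, hs₀, 1 / (4 * k'), by positivity, fun ψ hψ x ν hν t ht => ?_⟩
  obtain ⟨m, hm0, hm⟩ := hm ψ hψ x ν hν
  have habs : ∀ s ∈ Icc 0 s₀, |s| ≤ s₀ := fun s hs => by rw [abs_of_nonneg hs.1]; exact hs.2
  obtain ⟨hm1, hm2, -⟩ := hm t (habs t ht)
  have hmpos : 0 < ‖m t‖ := by linarith
  have hν' : ‖‖m t‖⁻¹ • m t‖ = 1 := by
    rw [norm_smul, norm_inv, norm_norm, inv_mul_cancel₀ hmpos.ne']
  have hr' : 0 < 1 / (4 * k') := by positivity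
  have key : ∀ a b : ℝ, 0 ≤ a → 0 ≤ k' * a + b → 0 ≤ a + 2 * (1 / (4 * k')) * (‖m t‖⁻¹ * b) := by
    intro a b ha hab
    have h1 : ‖m t‖⁻¹ ≤ 2 := by
      rw [inv_le_comm₀ hmpos (by norm_num)]; linarith
    have h2 : 0 ≤ ‖m t‖⁻¹ * (k' * a + b) := by positivity
    have h3 : 0 ≤ 2 * (k' * a) + ‖m t‖⁻¹ * b := by nlinarith [mul_nonneg hk'0.le ha]
    have h4 : a + 2 * (1 / (4 * k')) * (‖m t‖⁻¹ * b) =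
        (1 / (2 * k')) * (2 * (k' * a) + ‖m t‖⁻¹ * b) := by
      field_simp; ring
    rw [h4]; positivity
  refine ⟨‖m t‖⁻¹ • m t, hν', fun z => ⟨fun hz => ?_, fun hz => ?_⟩⟩
  · rw [mem_ball_sub_smul_iff hr hν, not_lt] at hz
    rw [mem_ball_sub_smul_iff hr' hν', not_lt, inner_smul_right]
    refine key _ _ (sq_nonneg _) ?_
    refine inner_add_sq_nonneg_of_flow hK hC0 hk0 (fun x y => hC x trivial y trivial) hψ
      (fun s hs => (hm s (habs s hs)).2) ?_ ht
    rw [hm0]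
    have : k * ‖z - x‖ ^ 2 + ⟪z - x, ν⟫ = k * (‖z - x‖ ^ 2 + 2 * r * ⟪z - x, ν⟫) := by
      rw [hk]; field_simp
    rw [this]; positivity
  · rw [mem_ball_add_smul_iff hr hν, not_lt] at hz
    rw [mem_ball_add_smul_iff hr' hν', not_lt, inner_smul_right]
    have h := key (‖ψ t z - ψ t x‖ ^ 2) (⟪ψ t z - ψ t x, -(m t)⟫) (sq_nonneg _) ?_
    · rw [inner_neg_right] at h; linarith
    refine inner_add_sq_nonneg_of_flow (m := fun s => -(m s)) hK hC0 hk0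
      (fun x y => hC x trivial y trivial) hψ (fun s hs => ⟨?_, ?_⟩) ?_ ht
    · rw [norm_neg]; exact (hm s (habs s hs)).2.1
    · rw [map_neg]; exact (hm s (habs s hs)).2.2.neg
    rw [hm0, inner_neg_right]
    have : k * ‖z - x‖ ^ 2 + -⟪z - x, ν⟫ = k * (‖z - x‖ ^ 2 - 2 * r * ⟪z - x, ν⟫) := by
      rw [hk]; field_simp; ring
    rw [this]
    exact mul_nonneg hk0.le (by linarith)

lemma exists_hasTwoSidedBalls_image_flow [FiniteDimensional ℝ E] (hX : ContDiff ℝ 2 X)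
    (hc : HasCompactSupport X) {Ω : Set E} {r : ℝ} (hr : 0 < r) (hb : HasTwoSidedBalls Ω r) :
    ∃ s₀ > 0, ∃ r' > 0, ∀ ψ, IsFlow X ψ → ∀ t ∈ Icc 0 s₀, HasTwoSidedBalls (ψ t '' Ω) r' := by
  obtain ⟨K, hK⟩ := hX.lipschitzWith_of_hasCompactSupport hc (by norm_num)
  obtain ⟨s₀, hs₀, r', hr', h⟩ := exists_flow_tangent_balls hX hc hr
  refine ⟨s₀, hs₀, r', hr', fun ψ hψ t ht y hy => ?_⟩
  have himg : frontier (ψ t '' Ω) = ψ t '' frontier Ω :=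
    ((hψ.homeomorph hK t).image_frontier Ω).symm
  rw [himg] at hy
  obtain ⟨x, hx, rfl⟩ := hy
  obtain ⟨ν, hν⟩ := hb x hx
  obtain ⟨ν', hν', h⟩ := h ψ hψ x ν hν.1 t ht
  refine ⟨ν', hν', fun y hy => ?_, ?_⟩
  · rw [← hψ.apply_neg_apply hK t y] at hy ⊢
    exact mem_image_of_mem _ (hν.2.1 (by_contra fun hz => (h _).1 hz hy))
  · rintro _ hy ⟨z, hz, rfl⟩
    exact (h z).2 (fun hz' => hν.2.2 hz' hz) hy

/-- Points on the boundary flow into the interior ball for small negative times and into the exterior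
ball for small positive times; by continuity no trajectory can leave `Ω` backwards in time. -/
lemma exists_closure_subset_image_flow (hX : ContDiff ℝ 2 X) (hc : HasCompactSupport X)
    {Ω : Set E} {r : ℝ} (hr : 0 < r) (hΩ : IsOpen Ω)
    (hout : ∀ x ∈ frontier Ω, ∃ ν, IsBallNormal Ω r x ν ∧ 1 / 2 ≤ ⟪X x, ν⟫) :
    ∃ s₀ > 0, ∀ ψ, IsFlow X ψ → ∀ t ∈ Ioc 0 s₀, closure Ω ⊆ ψ t '' Ω := by
  obtain ⟨K, hK⟩ := hX.lipschitzWith_of_hasCompactSupport hc (by norm_num)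
  obtain ⟨M, hM⟩ := hX.continuous.bounded_above_of_compact_support hc
  have hM0 : 0 ≤ M := (norm_nonneg _).trans (hM 0)
  set D : ℝ := M ^ 2 + 2 * r * (K * M) + 1 with hD
  have hD0 : 0 < D := by positivity
  refine ⟨r / (2 * D), by positivity, fun ψ hψ => ?_⟩
  have hquad : ∀ t ∈ Ioc 0 (r / (2 * D)), t ^ 2 * D < r * t := fun t ht => by
    have h1 := ht.2
    rw [le_div_iff₀ (by positivity)] at h1
    have := ht.1
    nlinarith [mul_pos this hD0]
  have hin : ∀ x ∈ frontier Ω, ∀ t ∈ Ioc 0 (r / (2 * D)), ψ (-t) x ∈ Ω := by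
    intro x hx t ht
    obtain ⟨ν, hν, hX⟩ := hout x hx
    apply hν.2.1
    rw [mem_ball_sub_smul_iff hr hν.1]
    have h1 := hψ.norm_sub_le hM (-t) x
    rw [abs_neg, abs_of_pos ht.1] at h1
    have h2 := (abs_real_inner_le_norm _ ν).trans
      (mul_le_mul_of_nonneg_right (hψ.norm_sub_sub_smul_le hK hM (-t) x) (norm_nonneg ν))
    rw [hν.1, mul_one, inner_sub_left, real_inner_smul_left, neg_sq] at h2
    have h3 := (abs_le.1 h2).2
    have h4 := pow_le_pow_left₀ (norm_nonneg _) h1 2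
    have h5 : ⟪ψ (-t) x - x, ν⟫ ≤ K * M * t ^ 2 - t / 2 := by nlinarith [ht.1]
    have h6 := hquad t ht
    have h7 := mul_le_mul_of_nonneg_left h5 (by positivity : 0 ≤ 2 * r)
    have h8 : 0 < t ^ 2 := pow_pos ht.1 2
    rw [hD] at h6
    nlinarith
  have hex : ∀ x ∈ frontier Ω, ∀ t ∈ Ioc 0 (r / (2 * D)), ψ t x ∉ Ω := by
    intro x hx t ht
    obtain ⟨ν, hν, hX⟩ := hout x hx
    apply hν.2.2
    rw [mem_ball_add_smul_iff hr hν.1]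
    have h1 := hψ.norm_sub_le hM t x
    rw [abs_of_pos ht.1] at h1
    have h2 := (abs_real_inner_le_norm _ ν).trans
      (mul_le_mul_of_nonneg_right (hψ.norm_sub_sub_smul_le hK hM t x) (norm_nonneg ν))
    rw [hν.1, mul_one, inner_sub_left, real_inner_smul_left] at h2
    have h3 := (abs_le.1 h2).1
    have h4 := pow_le_pow_left₀ (norm_nonneg _) h1 2
    have h5 : t / 2 - K * M * t ^ 2 ≤ ⟪ψ t x - x, ν⟫ := by nlinarith [ht.1]
    have h6 := hquad t ht
    have h7 := mul_le_mul_of_nonneg_left h5 (by positivity : 0 ≤ 2 * r)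
    have h8 : 0 < t ^ 2 := pow_pos ht.1 2
    rw [hD] at h6
    nlinarith
  intro t ht x hx
  refine ⟨ψ (-t) x, ?_, hψ.apply_neg_apply hK t x⟩
  by_cases hxΩ : x ∈ Ω
  swap
  · exact hin x (hΩ.frontier_eq ▸ ⟨hx, hxΩ⟩) t ht
  by_contra hne
  have hpc : IsPreconnected ((fun s : ℝ => ψ (-s) x) '' Icc 0 t) :=
    isPreconnected_Icc.image _ ((hψ.continuous_left x).comp continuous_neg).continuousOn
  obtain ⟨_, ⟨s, hs, rfl⟩, hsf⟩ := inter_frontier_nonempty_of_isPreconnected hpc hΩ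
    ⟨_, ⟨0, ⟨le_rfl, ht.1.le⟩, rfl⟩, by simpa [(hψ x).1] using hxΩ⟩
    ⟨_, ⟨t, ⟨ht.1.le, le_rfl⟩, rfl⟩, hne⟩
  simp only at hsf
  rcases hs.1.eq_or_lt with rfl | hs0
  · rw [neg_zero, (hψ x).1, hΩ.frontier_eq] at hsf
    exact hsf.2 hxΩ
  · refine hex _ hsf s ⟨hs0, hs.2.trans ht.2⟩ ?_
    rwa [hψ.apply_neg_apply hK]

open scoped Manifold in
/-- The conditions `1/2 < ⟨v, ν⟩` on the values of a vector field are convex, and since the normals are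
Lipschitz, they hold locally for constant fields; so a partition of unity gives a global field. -/
lemma exists_outward_field [FiniteDimensional ℝ E] {Ω : Set E} {r : ℝ} (hr : 0 < r)
    (hbd : Bornology.IsBounded Ω) (hb : HasTwoSidedBalls Ω r) :
    ∃ X : E → E, ContDiff ℝ ∞ X ∧ HasCompactSupport X ∧
      ∀ x ∈ frontier Ω, ∀ ν, IsBallNormal Ω r x ν → 1 / 2 ≤ ⟪X x, ν⟫ := by
  obtain ⟨s, hs⟩ := exists_contMDiffMap_forall_mem_convex_of_local_const (n := ⊤) 𝓘(ℝ, E)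
    (t := fun x => {v : E | x ∈ frontier Ω → ∀ ν, IsBallNormal Ω r x ν → 1 / 2 ≤ ⟪v, ν⟫})
    (fun x => by
      intro v hv w hw a b ha hb hab hx ν hν
      have h1 := hv hx ν hν
      have h2 := hw hx ν hν
      rw [inner_add_left, real_inner_smul_left, real_inner_smul_left]
      calc (1 / 2 : ℝ) = a * (1 / 2) + b * (1 / 2) := by rw [← add_mul, hab, one_mul]
        _ ≤ _ := by gcongr)
    (fun x => by
      by_cases hx : x ∈ frontier Ω
      · obtain ⟨ν, hν⟩ := hb x hx
        refine ⟨ν, ?_⟩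
        filter_upwards [Metric.ball_mem_nhds x hr] with y hy _ ξ hξ
        have h1 := hν.norm_sub_le hr hξ
        rw [← dist_eq_norm x, dist_comm] at h1
        have h2 : ‖ν - ξ‖ ≤ 1 := by
          have := h1.trans (Metric.mem_ball.1 hy).le
          nlinarith
        have h3 := norm_sub_sq_real ν ξ
        rw [hν.1, hξ.1] at h3
        nlinarith [norm_nonneg (ν - ξ)]
      · refine ⟨0, ?_⟩
        filter_upwards [isClosed_frontier.isOpen_compl.mem_nhds hx] with y hy hy'
        exact absurd hy' hy)
  obtain ⟨R, hR⟩ := hbd.closure.subset_closedBall 0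
  let χ : ContDiffBump (0 : E) := ⟨|R| + 1, |R| + 2, by positivity, by linarith⟩
  refine ⟨fun x => χ x • s x, χ.contDiff.smul s.contMDiff.contDiff,
    χ.hasCompactSupport.smul_right, fun x hx ν hν => ?_⟩
  have h1 : χ x = 1 := χ.one_of_mem_closedBall (by
    have := hR hx.1
    rw [Metric.mem_closedBall] at this ⊢
    exact this.trans ((le_abs_self R).trans (by simp [χ])))
  beta_reduce
  rw [h1, one_smul]
  exact hs x hx ν hν

end TransportBalls

section Semicontinuity

variable {N : ℕ} {μ : Set (EuclideanSpace ℝ (Fin N)) → ℝ}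

/-- Lower semicontinuity along approximations from outside the closure: the images of `Ω` under an
outward flow are neighbourhoods of `closure Ω`, so they contain the approximating sets. -/
lemma le_of_forall_isOpen_exists_subset
    (hmono : ∀ Ω₁ ∈ SubC N, ∀ Ω₂ ∈ SubC N, Ω₁ ⊆ Ω₂ → μ Ω₂ ≤ μ Ω₁)
    (hflow : ∀ Ω ∈ SubC N, ∀ X : EuclideanSpace ℝ (Fin N) → EuclideanSpace ℝ (Fin N),
      ContDiff ℝ ∞ X → HasCompactSupport X → IsOutwardPointing Ω X →
      ∀ ψ : ℝ → EuclideanSpace ℝ (Fin N) → EuclideanSpace ℝ (Fin N),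
      IsGlobalFlow X ψ → Tendsto (fun t => μ (ψ t '' Ω)) (𝓝[>] 0) (𝓝 (μ Ω)))
    {r a : ℝ} (hr : 0 < r) {Ω : Set (EuclideanSpace ℝ (Fin N))} (hΩ : Ω ∈ SBall N r)
    (h : ∀ O, IsOpen O → closure Ω ⊆ O → ∃ Ω' ∈ SubC N, Ω' ⊆ O ∧ μ Ω' ≤ a) : μ Ω ≤ a := by
  obtain ⟨hne, hop, hbd, hb⟩ := (mem_sBall_iff hr).1 hΩ
  obtain ⟨X, hX, hc, hout⟩ := exists_outward_field hr hbd hb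
  have hX2 : ContDiff ℝ 2 X := by exact_mod_cast contDiff_infty.1 hX 2
  obtain ⟨K, hK⟩ := hX2.lipschitzWith_of_hasCompactSupport hc (by norm_num)
  obtain ⟨M, hM⟩ := hX.continuous.bounded_above_of_compact_support hc
  obtain ⟨ψ, hψ⟩ := exists_globalFlow hK hM
  have hpoint : IsOutwardPointing Ω X := fun x hx => by
    obtain ⟨ν, hν⟩ := hb x hx
    exact ⟨ν, hν.isOutwardNormal hr hop hb hx, by linarith [hout x hx ν hν]⟩
  have hlim := hflow Ω hΩ.1 X hX hc hpoint ψ hψ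
  obtain ⟨s₁, hs₁, r', hr', h₁⟩ := exists_hasTwoSidedBalls_image_flow hX2 hc hr hb
  obtain ⟨s₂, hs₂, h₂⟩ := exists_closure_subset_image_flow hX2 hc hr hop fun x hx =>
    (hb x hx).imp fun ν hν => ⟨hν, hout x hx ν hν⟩
  refine le_of_tendsto hlim ?_
  filter_upwards [Ioc_mem_nhdsGT hs₁, Ioc_mem_nhdsGT hs₂] with t ht₁ ht₂
  have hopen : IsOpen (ψ t '' Ω) := (hψ.homeomorph hK t).isOpenMap Ω hop
  obtain ⟨Ω', hΩ', hsub, hle⟩ := h _ hopen (h₂ ψ hψ t ht₂)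
  refine (hmono Ω' hΩ' _ ?_ hsub).trans hle
  refine (h₁ ψ hψ t ⟨ht₁.1.le, ht₁.2⟩).mem_subC hr' (hne.image _) hopen ?_
  have hcomp : IsCompact (closure Ω) := hbd.isCompact_closure
  exact (hcomp.image (hψ.continuous hK t)).isBounded.subset (image_mono subset_closure)

end Semicontinuity

/-! ### Compactness of domains with two-sided tangent balls -/

section Compactness

/-- The boundary has no density points, since each of its points is touched by balls of arbitrarily
small radius contained in `Ω`. -/
lemma HasTwoSidedBalls.volume_frontier {E : Type*} [NormedAddCommGroup E] [InnerProductSpace ℝ E]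
    [FiniteDimensional ℝ E] [MeasurableSpace E] [BorelSpace E] {Ω : Set E} {r : ℝ}
    (hr : 0 < r) (hΩ : IsOpen Ω) (hb : HasTwoSidedBalls Ω r) :
    volume (frontier Ω) = 0 := by
  have h := Besicovitch.ae_tendsto_measure_inter_div volume (frontier Ω)
  rw [ae_restrict_iff' isClosed_frontier.measurableSet] at h
  rw [measure_eq_zero_iff_ae_notMem]
  filter_upwards [h] with x hx hxf
  have hlim := hx hxf
  obtain ⟨ν, hν⟩ := hb x hxf
  set c : ENNReal := ENNReal.ofReal ((1 / 2) ^ Module.finrank ℝ E) with hc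
  have hc0 : c ≠ 0 := by
    rw [hc, Ne, ENNReal.ofReal_eq_zero, not_le]; positivity
  have hle : ∀ᶠ s in 𝓝[>] (0 : ℝ), volume (frontier Ω ∩ Metric.closedBall x s) /
      volume (Metric.closedBall x s) + c ≤ 1 := by
    filter_upwards [Ioc_mem_nhdsGT hr] with s hs
    have hs2 : 0 < s / 2 := by have := hs.1; positivity
    have hsub : Metric.ball (x - (s / 2) • ν) (s / 2) ⊆ Ω :=
      (hν.mono (by linarith [hs.1, hs.2])).2.1
    have hsub2 : Metric.ball (x - (s / 2) • ν) (s / 2) ⊆ Metric.closedBall x s := by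
      refine (Metric.ball_subset_ball' ?_).trans Metric.ball_subset_closedBall
      rw [dist_eq_norm, sub_sub_cancel_left, norm_neg, norm_smul, hν.1, mul_one,
        Real.norm_of_nonneg hs2.le]
      linarith
    have hdisj : Disjoint (frontier Ω ∩ Metric.closedBall x s)
        (Metric.ball (x - (s / 2) • ν) (s / 2)) := by
      rw [Set.disjoint_left]
      rintro y ⟨hy, -⟩ hy'
      exact (hΩ.frontier_eq ▸ hy).2 (hsub hy')
    have hsum : volume (frontier Ω ∩ Metric.closedBall x s) +
        volume (Metric.ball (x - (s / 2) • ν) (s / 2)) ≤ volume (Metric.closedBall x s) := by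
      rw [← measure_union hdisj measurableSet_ball]
      exact measure_mono (union_subset inter_subset_right hsub2)
    have hball : volume (Metric.ball (x - (s / 2) • ν) (s / 2))
        = c * volume (Metric.closedBall x s) := by
      rw [Measure.addHaar_ball_of_pos _ _ hs2, Measure.addHaar_closedBall _ _ hs.1.le, hc,
        ← mul_assoc, ← ENNReal.ofReal_mul (by positivity), ← mul_pow]
      congr 4; ring
    have hpos : volume (Metric.closedBall x s) ≠ 0 :=
      (Metric.measure_closedBall_pos volume x hs.1).ne'
    have hfin : volume (Metric.closedBall x s) ≠ ⊤ := measure_closedBall_lt_top.ne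
    have hc' : c = c * volume (Metric.closedBall x s) / volume (Metric.closedBall x s) :=
      (ENNReal.mul_div_cancel_right hpos hfin).symm
    rw [hc', ← ENNReal.add_div, ← hball]
    exact ENNReal.div_le_of_le_mul (by rwa [one_mul])
  have h1 : (1 : ENNReal) + c ≤ 1 := le_of_tendsto (hlim.add_const c) hle
  have h2 : (1 : ENNReal) < 1 + c := ENNReal.lt_add_right ENNReal.one_ne_top hc0
  exact absurd h1 (not_le.2 h2)

lemma exists_tendsto_of_ultrafilter {ι X : Type*} [TopologicalSpace X] (𝓤 : Ultrafilter ι)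
    {f : ι → X} {s : Set X} (hs : IsCompact s) (hf : ∀ᶠ i in 𝓤, f i ∈ s) :
    ∃ a ∈ s, Tendsto f 𝓤 (𝓝 a) :=
  hs.ultrafilter_le_nhds (𝓤.map f) (le_principal_iff.2 hf)

lemma exists_mem_frontier_dist_le {E : Type*} [NormedAddCommGroup E] [NormedSpace ℝ E]
    [FiniteDimensional ℝ E] {Ω : Set E} (hne : Ω.Nonempty) (hne' : Ωᶜ.Nonempty) (x : E) :
    ∃ y ∈ frontier Ω, dist x y ≤ Metric.infDist x Ωᶜ + Metric.infDist x Ω := by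
  by_cases hx : x ∈ Ω
  · obtain ⟨y, hy, h⟩ := exists_mem_frontier_infDist_compl_eq_dist hx
      (by rwa [← nonempty_compl])
    exact ⟨y, hy, by rw [h]; linarith [Metric.infDist_nonneg (x := x) (s := Ω)]⟩
  · obtain ⟨y, hy, h⟩ := exists_mem_frontier_infDist_compl_eq_dist (s := Ωᶜ) hx
      (by rwa [← nonempty_compl, compl_compl])
    rw [compl_compl] at h
    rw [frontier_compl] at hy
    exact ⟨y, hy, by rw [h]; linarith [Metric.infDist_nonneg (x := x) (s := Ωᶜ)]⟩

lemma tendsto_of_lipschitz_of_tendsto {ι E : Type*} [PseudoMetricSpace E] {l : Filter ι}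
    {f : ι → E → ℝ} (hf : ∀ i, LipschitzWith 1 (f i)) {a : E} {b : ℝ}
    (h : Tendsto (fun i => f i a) l (𝓝 b)) {x : ι → E} (hx : Tendsto x l (𝓝 a)) :
    Tendsto (fun i => f i (x i)) l (𝓝 b) := by
  refine h.congr_dist ?_
  refine squeeze_zero (fun _ => dist_nonneg) (fun i => ?_)
    (tendsto_iff_dist_tendsto_zero.1 hx)
  simpa [dist_comm] using (hf i).dist_le_mul a (x i)

variable {E : Type*} [NormedAddCommGroup E] [InnerProductSpace ℝ E] [FiniteDimensional ℝ E]

/-- The limit of uniformly bounded domains is taken in the sense of signed distances: `u` and `v` are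
the limits of the distances to the complement and to the domain, and the limit domain is `{u > 0}`.
Its boundary is `{u = v = 0}`, where the tangent balls of the approximating domains survive. Limits
along an ultrafilter make a choice of subsequences unnecessary. -/
lemma exists_limit_domain {ι : Type*} (𝓤 : Ultrafilter ι) [Nontrivial E] {r R : ℝ} (hr : 0 < r)
    {Ω : ι → Set E} (hne : ∀ i, (Ω i).Nonempty)
    (hR : ∀ i, Ω i ⊆ Metric.closedBall 0 R) (hb : ∀ i, HasTwoSidedBalls (Ω i) r) :
    ∃ Ω' : Set E, Ω'.Nonempty ∧ IsOpen Ω' ∧ Ω' ⊆ Metric.closedBall 0 R ∧ HasTwoSidedBalls Ω' r ∧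
      (∀ O, IsOpen O → closure Ω' ⊆ O → ∀ᶠ i in 𝓤, Ω i ⊆ O) ∧
      ∀ K ⊆ Ω', IsCompact K → ∀ᶠ i in 𝓤, K ⊆ Ω i := by
  obtain ⟨y₀, hy₀⟩ : ∃ y : E, R < ‖y‖ := NormedSpace.exists_lt_norm ℝ E R
  have hy₀c : ∀ i, y₀ ∈ (Ω i)ᶜ := fun i hi => by
    have := hR i hi
    rw [mem_closedBall_zero_iff] at this
    linarith
  set d : ι → E → ℝ := fun i x => Metric.infDist x (Ω i)ᶜ with hd
  set e : ι → E → ℝ := fun i x => Metric.infDist x (Ω i) with he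
  have hdL : ∀ i, LipschitzWith 1 (d i) := fun i => Metric.lipschitz_infDist_pt _
  have heL : ∀ i, LipschitzWith 1 (e i) := fun i => Metric.lipschitz_infDist_pt _
  have hu : ∀ x, ∃ a ∈ Icc 0 (dist x y₀), Tendsto (fun i => d i x) 𝓤 (𝓝 a) := fun x =>
    exists_tendsto_of_ultrafilter 𝓤 isCompact_Icc (Eventually.of_forall fun i =>
      ⟨Metric.infDist_nonneg, Metric.infDist_le_dist_of_mem (hy₀c i)⟩)
  have hv : ∀ x, ∃ a ∈ Icc 0 (‖x‖ + R), Tendsto (fun i => e i x) 𝓤 (𝓝 a) := fun x =>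
    exists_tendsto_of_ultrafilter 𝓤 isCompact_Icc (Eventually.of_forall fun i => by
      obtain ⟨y, hy⟩ := hne i
      refine ⟨Metric.infDist_nonneg, (Metric.infDist_le_dist_of_mem hy).trans ?_⟩
      have := mem_closedBall_zero_iff.1 (hR i hy)
      rw [dist_eq_norm]
      exact (norm_sub_le _ _).trans (by linarith))
  choose u hu hud using hu
  choose v hv hve using hv
  have huL : LipschitzWith 1 u := LipschitzWith.of_dist_le_mul fun x y => by
    rw [NNReal.coe_one, one_mul]
    refine le_of_tendsto ((hud x).dist (hud y)) (Eventually.of_forall fun i => ?_)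
    simpa using (hdL i).dist_le_mul x y
  have hvL : LipschitzWith 1 v := LipschitzWith.of_dist_le_mul fun x y => by
    rw [NNReal.coe_one, one_mul]
    refine le_of_tendsto ((hve x).dist (hve y)) (Eventually.of_forall fun i => ?_)
    simpa using (heL i).dist_le_mul x y
  have hu1 : ∀ x, 0 < u x → ∀ᶠ i in 𝓤, x ∈ Ω i := fun x hx => by
    filter_upwards [(hud x).eventually (lt_mem_nhds hx)] with i hi
    by_contra hxi
    exact hi.ne' (Metric.infDist_zero_of_mem hxi)
  have hv1 : ∀ x, 0 < v x → ∀ᶠ i in 𝓤, x ∉ Ω i := fun x hx => by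
    filter_upwards [(hve x).eventually (lt_mem_nhds hx)] with i hi hxi
    exact hi.ne' (Metric.infDist_zero_of_mem hxi)
  have huv : ∀ x, 0 < v x → ¬ 0 < u x := fun x hx hx' => by
    obtain ⟨i, h1, h2⟩ := ((hu1 x hx').and (hv1 x hx)).exists
    exact h2 h1
  set Ω' : Set E := {x | 0 < u x} with hΩ'
  have hopen : IsOpen Ω' := isOpen_lt continuous_const huL.continuous
  have hnormal : ∀ x, u x = 0 → v x = 0 → ∃ ν, IsBallNormal Ω' r x ν := by
    intro x hux hvx
    choose p hp hpd using fun i => exists_mem_frontier_dist_le (hne i) ⟨y₀, hy₀c i⟩ x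
    choose n hn using fun i => hb i (p i) (hp i)
    have hpx : Tendsto p 𝓤 (𝓝 x) := by
      rw [tendsto_iff_dist_tendsto_zero]
      refine squeeze_zero (fun _ => dist_nonneg) (fun i => ?_)
        (show Tendsto (fun i => d i x + e i x) 𝓤 (𝓝 0) by
          simpa [hux, hvx] using (hud x).add (hve x))
      rw [dist_comm]
      exact hpd i
    obtain ⟨ν, hν, hnν⟩ := exists_tendsto_of_ultrafilter 𝓤 (isCompact_sphere (0 : E) 1)
      (f := n) (Eventually.of_forall fun i => by simpa using (hn i).1)
    -- A ball of radius `r` around the limit of the centers is in the limit of the balls.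
    have hball : ∀ (c : ι → E) (c₀ z : E), Tendsto c 𝓤 (𝓝 c₀) → z ∈ Metric.ball c₀ r →
        ∃ δ > 0, ∀ᶠ i in 𝓤, Metric.ball z δ ⊆ Metric.ball (c i) r := by
      intro c c₀ z hc hz
      rw [Metric.mem_ball] at hz
      refine ⟨(r - dist z c₀) / 2, by linarith, ?_⟩
      have h1 : Tendsto (fun i => dist z (c i)) 𝓤 (𝓝 (dist z c₀)) := tendsto_const_nhds.dist hc
      filter_upwards [h1.eventually (gt_mem_nhds (show dist z c₀ < (r + dist z c₀) / 2 by linarith))]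
        with i hi
      exact Metric.ball_subset_ball' (by linarith)
    have hle : ∀ {s : Set E} {z : E} {δ : ℝ}, s.Nonempty → Metric.ball z δ ⊆ sᶜ →
        δ ≤ Metric.infDist z s := fun hs hsub => (Metric.le_infDist hs).2 fun y hy => by
      by_contra! hlt
      exact hsub (Metric.mem_ball'.2 hlt) hy
    refine ⟨ν, by simpa using hν, fun z hz => ?_, fun z hz => ?_⟩
    · obtain ⟨δ, hδ, h⟩ := hball (fun i => p i - r • n i) _ z (hpx.sub (hnν.const_smul r)) hz
      refine lt_of_lt_of_le hδ (ge_of_tendsto (hud z) ?_)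
      filter_upwards [h] with i hi
      refine hle ⟨y₀, hy₀c i⟩ ?_
      rw [compl_compl]
      exact hi.trans (hn i).2.1
    · obtain ⟨δ, hδ, h⟩ := hball (fun i => p i + r • n i) _ z (hpx.add (hnν.const_smul r)) hz
      refine huv z (lt_of_lt_of_le hδ (ge_of_tendsto (hve z) ?_))
      filter_upwards [h] with i hi
      exact hle (hne i) (hi.trans (hn i).2.2)
  have hfr : ∀ x ∈ frontier Ω', u x = 0 ∧ v x = 0 := by
    intro x hx
    have hcl : closure Ω' ⊆ {x | v x ≤ 0} := closure_minimal
      (fun y hy => not_lt.1 fun h => huv y h hy) (isClosed_le hvL.continuous continuous_const)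
    rw [hopen.frontier_eq] at hx
    exact ⟨le_antisymm (not_lt.1 hx.2) (hu x).1, le_antisymm (hcl hx.1) (hv x).1⟩
  have hout : ∀ O, IsOpen O → closure Ω' ⊆ O → ∀ᶠ i in 𝓤, Ω i ⊆ O := by
    intro O hO hsub
    by_contra hnot
    rw [← Ultrafilter.eventually_not] at hnot
    have hex : ∀ i, ∃ x, ¬ Ω i ⊆ O → x ∈ Ω i ∧ x ∉ O := fun i => by
      by_cases h : Ω i ⊆ O
      · exact ⟨0, fun h' => absurd h h'⟩
      · obtain ⟨x, hx⟩ := not_subset.1 h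
        exact ⟨x, fun _ => hx⟩
    choose x hx using hex
    obtain ⟨a, ha, hxa⟩ := exists_tendsto_of_ultrafilter 𝓤
      ((isCompact_closedBall (0 : E) R).inter_right hO.isClosed_compl) (f := x)
      (hnot.mono fun i hi => ⟨hR i (hx i hi).1, (hx i hi).2⟩)
    have hva : v a = 0 := by
      refine tendsto_nhds_unique (tendsto_of_lipschitz_of_tendsto heL (hve a) hxa)
        (tendsto_const_nhds.congr' ?_)
      filter_upwards [hnot] with i hi
      exact (Metric.infDist_zero_of_mem (hx i hi).1).symm
    refine ha.2 (hsub ?_)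
    rcases (hu a).1.eq_or_lt with hua | hua
    · obtain ⟨ν, hν⟩ := hnormal a hua.symm hva
      refine closure_mono hν.2.1 ?_
      rw [closure_ball _ hr.ne']
      exact Metric.sphere_subset_closedBall (mem_sphere_sub_smul hr hν.1)
    · exact subset_closure hua
  refine ⟨Ω', ?_, hopen, fun x hx => ?_, fun x hx => hnormal x (hfr x hx).1 (hfr x hx).2, hout,
    fun K hK hKc => ?_⟩
  · by_contra hemp
    rw [not_nonempty_iff_eq_empty] at hemp
    obtain ⟨i, hi⟩ := (hout ∅ isOpen_empty (by simp [hemp])).exists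
    obtain ⟨x, hx⟩ := hne i
    exact hi hx
  · obtain ⟨i, hi⟩ := (hu1 x hx).exists
    exact hR i hi
  · by_contra hnot
    rw [← Ultrafilter.eventually_not] at hnot
    have hex : ∀ i, ∃ x, ¬ K ⊆ Ω i → x ∈ K ∧ x ∉ Ω i := fun i => by
      by_cases h : K ⊆ Ω i
      · exact ⟨0, fun h' => absurd h h'⟩
      · obtain ⟨x, hx⟩ := not_subset.1 h
        exact ⟨x, fun _ => hx⟩
    choose x hx using hex
    obtain ⟨a, ha, hxa⟩ := exists_tendsto_of_ultrafilter 𝓤 hKc (f := x)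
      (hnot.mono fun i hi => (hx i hi).1)
    have hua : u a = 0 := by
      refine tendsto_nhds_unique (tendsto_of_lipschitz_of_tendsto hdL (hud a) hxa)
        (tendsto_const_nhds.congr' ?_)
      filter_upwards [hnot] with i hi
      exact (Metric.infDist_zero_of_mem (hx i hi).2).symm
    exact (hK ha).ne' hua

lemma exists_limit_sBallVol {ι : Type*} (𝓤 : Ultrafilter ι) {N : ℕ} (hN : 1 ≤ N) {r R V : ℝ}
    (hr : 0 < r) {Ω : ι → Set (EuclideanSpace ℝ (Fin N))} (hΩ : ∀ i, Ω i ∈ SBallVol N r V)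
    (hR : ∀ i, Ω i ⊆ Metric.closedBall 0 R) :
    ∃ Ω' ∈ SBallVol N r V, ∀ O, IsOpen O → closure Ω' ⊆ O → ∀ᶠ i in 𝓤, Ω i ⊆ O := by
  have : Nonempty (Fin N) := ⟨⟨0, hN⟩⟩
  have hΩ1 := fun i => (mem_sBall_iff hr).1 (hΩ i).1
  obtain ⟨Ω', hne, hop, hsub, hb, hout, hin⟩ := exists_limit_domain 𝓤 hr (fun i => (hΩ1 i).1)
    hR (fun i => (hΩ1 i).2.2.2)
  have hbd : Bornology.IsBounded Ω' := Metric.isBounded_closedBall.subset hsub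
  refine ⟨Ω', ⟨hb.mem_sBall hr hne hop hbd, ?_⟩, hout⟩
  have hvol : ∀ i, volume (Ω i) = ENNReal.ofReal V := fun i => by
    rw [← (hΩ i).2, Measure.real, ENNReal.ofReal_toReal (hΩ1 i).2.2.1.measure_lt_top.ne]
  have hV : 0 ≤ V := by
    obtain ⟨i⟩ : Nonempty ι := nonempty_of_neBot (𝓤 : Filter ι)
    rw [← (hΩ i).2]; exact measureReal_nonneg
  have h1 : volume Ω' ≤ ENNReal.ofReal V := by
    rw [hop.measure_eq_iSup_isCompact]
    refine iSup₂_le fun K hK => iSup_le fun hKc => ?_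
    obtain ⟨i, hi⟩ := (hin K hK hKc).exists
    exact (measure_mono hi).trans (hvol i).le
  have h2 : ENNReal.ofReal V ≤ volume (closure Ω') := by
    rw [(closure Ω').measure_eq_iInf_isOpen]
    refine le_iInf₂ fun O hO => le_iInf fun hOo => ?_
    obtain ⟨i, hi⟩ := (hout O hOo hO).exists
    exact (hvol i).ge.trans (measure_mono hi)
  have h3 : volume (closure Ω') ≤ volume Ω' := by
    rw [closure_eq_self_union_frontier]
    refine (measure_union_le _ _).trans ?_
    rw [hb.volume_frontier hr hop, add_zero]
  rw [Measure.real, le_antisymm h1 (h2.trans h3), ENNReal.toReal_ofReal hV]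

end Compactness

/-! ### Splitting off components -/

section Components

variable {E : Type*} [NormedAddCommGroup E] [InnerProductSpace ℝ E] {Ω A B : Set E} {r : ℝ}

/-- A point of `Ω` lies on the normal line through the nearest boundary point. -/
lemma exists_isBallNormal_eq_sub_smul [FiniteDimensional ℝ E] (hr : 0 < r) (hΩ : IsOpen Ω)
    (hne : Ωᶜ.Nonempty) (hb : HasTwoSidedBalls Ω r) {b : E} (hbΩ : b ∈ Ω) :
    ∃ p ∈ frontier Ω, ∃ ν, IsBallNormal Ω r p ν ∧ 0 < dist b p ∧
      dist b p = Metric.infDist b Ωᶜ ∧ b = p - dist b p • ν := by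
  obtain ⟨p, hp, hd⟩ := exists_mem_frontier_infDist_compl_eq_dist hbΩ (by rwa [← nonempty_compl])
  obtain ⟨ν, hν⟩ := hb p hp
  have hpos : 0 < dist b p := dist_pos.2 fun h => (hΩ.frontier_eq ▸ hp).2 (h ▸ hbΩ)
  have hmin : 0 < min (dist b p) r := lt_min hpos hr
  obtain ⟨ξ, hξ, hbξ⟩ := exists_isBallNormal_of_mem_sphere hmin (min_le_left _ _)
    (min_le_right _ _) (hd ▸ Metric.ball_infDist_compl_subset) hν.2.2
    (Metric.mem_sphere'.2 rfl) (mem_sphere_add_smul hr hν.1)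
  have h := hξ.norm_sub_le hmin (hν.mono (min_le_right _ _))
  have hνξ : ξ = ν := by
    rw [sub_self, norm_zero] at h
    rw [← sub_eq_zero, ← norm_eq_zero]
    nlinarith [norm_nonneg (ξ - ν)]
  exact ⟨p, hp, ν, hν, hpos, hd.symm, hνξ ▸ hbξ⟩

lemma mem_ball_of_eq_sub_smul {b p ν : E} (hν : ‖ν‖ = 1) {t : ℝ} (ht : 0 < t) (htr : t < 2 * r)
    (hb : b = p - t • ν) : b ∈ Metric.ball (p - r • ν) r := by
  rw [mem_ball_iff_norm, hb, show p - t • ν - (p - r • ν) = (r - t) • ν by module, norm_smul, hν,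
    mul_one, Real.norm_eq_abs, abs_lt]
  constructor <;> linarith

lemma HasTwoSidedBalls.exists_mem_ball_subset [FiniteDimensional ℝ E] (hr : 0 < r)
    (hΩ : IsOpen Ω) (hne : Ωᶜ.Nonempty) (hb : HasTwoSidedBalls Ω r) {b : E} (hbΩ : b ∈ Ω) :
    ∃ y, b ∈ Metric.ball y r ∧ Metric.ball y r ⊆ Ω := by
  obtain ⟨p, hp, ν, hν, hpos, hd, hbp⟩ := exists_isBallNormal_eq_sub_smul hr hΩ hne hb hbΩ
  by_cases h : dist b p < 2 * r
  · exact ⟨_, mem_ball_of_eq_sub_smul hν.1 hpos h hbp, hν.2.1⟩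
  · refine ⟨b, Metric.mem_ball_self hr, ?_⟩
    exact (Metric.ball_subset_ball (by linarith)).trans Metric.ball_infDist_compl_subset

/-- Near a boundary point `x`, all points of `Ω` can be joined within `Ω` to the interior ball at `x`:
they lie in the interior balls at nearby boundary points, which overlap with the one at `x`. -/
lemma ball_subset_of_mem_closure [FiniteDimensional ℝ E] (hr : 0 < r)
    (hb : HasTwoSidedBalls (A ∪ B) r) (hA : IsOpen A) (hB : IsOpen B) (hAB : Disjoint A B)
    {x ν : E} (hx : x ∈ closure A) (hxΩ : x ∉ A ∪ B) (hν : IsBallNormal (A ∪ B) r x ν) :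
    Metric.ball (x - r • ν) r ⊆ A := by
  have hconn : ∀ y : E, Metric.ball y r ⊆ A ∪ B → (Metric.ball y r ∩ A).Nonempty →
      Metric.ball y r ⊆ A := fun y hy hne =>
    (convex_ball y r).isPreconnected.subset_left_of_subset_union hA hB hAB hy hne
  obtain ⟨b, hbA, hbx⟩ := Metric.mem_closure_iff.1 hx (r / 4) (by positivity)
  obtain ⟨p, hp, ξ, hξ, hpos, hd, hbp⟩ := exists_isBallNormal_eq_sub_smul hr (hA.union hB)
    ⟨x, hxΩ⟩ hb (Or.inl hbA)
  have hdle : dist b p ≤ dist b x := hd ▸ Metric.infDist_le_dist_of_mem hxΩ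
  rw [dist_comm] at hbx
  have hy : Metric.ball (p - r • ξ) r ⊆ A := hconn _ hξ.2.1
    ⟨b, mem_ball_of_eq_sub_smul hξ.1 hpos (by linarith) hbp, hbA⟩
  refine hconn _ hν.2.1 ⟨p - r • ξ, ?_, hy (Metric.mem_ball_self hr)⟩
  have h1 := hν.norm_sub_le hr hξ
  have h2 : ‖x - p‖ ≤ 2 * dist b x := by
    rw [← dist_eq_norm]; linarith [dist_triangle_left x p b]
  rw [mem_ball_iff_norm, show p - r • ξ - (x - r • ν) = r • (ν - ξ) - (x - p) by module]
  refine (norm_sub_le _ _).trans_lt ?_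
  rw [norm_smul, Real.norm_of_nonneg hr.le]
  linarith

lemma HasTwoSidedBalls.left_of_union [FiniteDimensional ℝ E] (hr : 0 < r)
    (hb : HasTwoSidedBalls (A ∪ B) r) (hA : IsOpen A) (hB : IsOpen B) (hAB : Disjoint A B) :
    HasTwoSidedBalls A r := by
  intro x hx
  rw [hA.frontier_eq] at hx
  have hxB : x ∉ B := fun h => (hAB.closure_left hB).le_bot ⟨hx.1, h⟩
  have hxΩ : x ∉ A ∪ B := fun h => h.elim hx.2 hxB
  obtain ⟨ν, hν⟩ := hb x ((hA.union hB).frontier_eq ▸ ⟨closure_mono subset_union_left hx.1, hxΩ⟩)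
  exact ⟨ν, hν.1, ball_subset_of_mem_closure hr hb hA hB hAB hx.1 hxΩ hν,
    hν.2.2.trans (compl_subset_compl.2 subset_union_left)⟩

lemma HasTwoSidedBalls.closure_inter_closure [FiniteDimensional ℝ E] (hr : 0 < r)
    (hb : HasTwoSidedBalls (A ∪ B) r) (hA : IsOpen A) (hB : IsOpen B) (hAB : Disjoint A B) :
    closure A ∩ closure B = ∅ := by
  rw [eq_empty_iff_forall_notMem]
  rintro x ⟨hxA, hxB⟩
  have hxΩ : x ∉ A ∪ B := fun h => h.elim
    (fun h => (hAB.closure_right hA).le_bot ⟨h, hxB⟩)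
    (fun h => (hAB.closure_left hB).le_bot ⟨hxA, h⟩)
  obtain ⟨ν, hν⟩ := hb x ((hA.union hB).frontier_eq ▸
    ⟨closure_mono subset_union_left hxA, hxΩ⟩)
  have h1 := ball_subset_of_mem_closure hr hb hA hB hAB hxA hxΩ hν
  rw [union_comm] at hb hxΩ hν
  have h2 := ball_subset_of_mem_closure hr hb hB hA hAB.symm hxB hxΩ hν
  exact hAB.le_bot ⟨h1 (Metric.mem_ball_self hr), h2 (Metric.mem_ball_self hr)⟩

/-- Separated domains can be joined. -/
lemma HasTwoSidedBalls.union (hA : HasTwoSidedBalls A r)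
    (hB : HasTwoSidedBalls B r) (hAo : IsOpen A) (hBo : IsOpen B)
    (hd : ∀ a ∈ A, ∀ b ∈ B, 2 * r ≤ dist a b) : HasTwoSidedBalls (A ∪ B) r := by
  -- The exterior ball at a boundary point of one set has diameter `2 r`, so it misses the other set.
  have key : ∀ {A B : Set E}, HasTwoSidedBalls A r → IsOpen A →
      (∀ a ∈ A, ∀ b ∈ B, 2 * r ≤ dist a b) → ∀ x ∈ closure A, x ∉ A →
      ∃ ν, IsBallNormal (A ∪ B) r x ν := by
    intro A B hA hAo hd x hx hxA
    obtain ⟨ν, hν⟩ := hA x (hAo.frontier_eq ▸ ⟨hx, hxA⟩)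
    refine ⟨ν, hν.1, hν.2.1.trans subset_union_left, ?_⟩
    rw [compl_union]
    refine subset_inter hν.2.2 fun w hw hwB => ?_
    have h1 : 2 * r ≤ dist x w :=
      closure_minimal (fun a ha => hd a ha w hwB)
        (isClosed_le continuous_const (continuous_id.dist continuous_const)) hx
    have hr : 0 < r := Metric.pos_of_mem_ball hw
    have h2 : dist (x + r • ν) x = r := by
      rw [dist_eq_norm, add_sub_cancel_left, norm_smul, hν.1, mul_one, Real.norm_of_nonneg hr.le]
    linarith [dist_triangle_left x w (x + r • ν), Metric.mem_ball'.1 hw]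
  intro x hx
  rw [(hAo.union hBo).frontier_eq, closure_union] at hx
  rcases hx.1 with h | h
  · exact key hA hAo hd x h fun h => hx.2 (Or.inl h)
  · rw [union_comm]
    exact key hB hBo (fun b hb a ha => by rw [dist_comm]; exact hd a ha b hb) x h
      fun h => hx.2 (Or.inr h)

lemma closure_inter_closure_eq_empty_of_dist {X : Type*} [PseudoMetricSpace X] {A B : Set X}
    (hr : 0 < r)
    (hd : ∀ a ∈ A, ∀ b ∈ B, 2 * r ≤ dist a b) : closure A ∩ closure B = ∅ := by
  rw [eq_empty_iff_forall_notMem]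
  rintro x ⟨hxA, hxB⟩
  have h1 : ∀ b ∈ B, 2 * r ≤ dist x b := fun b hb =>
    closure_minimal (fun a ha => hd a ha b hb)
      (isClosed_le continuous_const (continuous_id.dist continuous_const)) hxA
  have h2 : 2 * r ≤ dist x x := closure_minimal (s := B) (t := {b | 2 * r ≤ dist x b}) h1
      (isClosed_le continuous_const (continuous_const.dist continuous_id)) hxB
  rw [dist_self] at h2
  linarith

lemma hasTwoSidedBalls_ball {c : E} {ρ : ℝ} (hr : 0 < r) (hρ : r ≤ ρ) :
    HasTwoSidedBalls (Metric.ball c ρ) r := by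
  have hρ0 : 0 < ρ := hr.trans_le hρ
  intro x hx
  rw [frontier_ball c hρ0.ne'] at hx
  have hx' := mem_sphere_iff_norm.1 hx
  have hν : ‖ρ⁻¹ • (x - c)‖ = 1 := by
    rw [norm_smul, hx', Real.norm_of_nonneg (inv_nonneg.2 hρ0.le), inv_mul_cancel₀ hρ0.ne']
  have hsm : ρ • ρ⁻¹ • (x - c) = x - c := smul_inv_smul₀ hρ0.ne' _
  refine ⟨ρ⁻¹ • (x - c), IsBallNormal.mono (r := ρ) ⟨hν, ?_, ?_⟩ hρ⟩
  · rw [hsm, sub_sub_cancel]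
  · rw [hsm, subset_compl_iff_disjoint_right, disjoint_ball_ball_iff hρ0 hρ0, dist_eq_norm,
      show x + (x - c) - c = (2 : ℝ) • (x - c) by module, norm_smul, hx', Real.norm_ofNat]
    linarith

lemma HasTwoSidedBalls.image_add (hb : HasTwoSidedBalls Ω r) (a : E) :
    HasTwoSidedBalls ((fun y => a + y) '' Ω) r := by
  intro x hx
  have himg : frontier ((fun y => a + y) '' Ω) = (fun y => a + y) '' frontier Ω :=
    ((Homeomorph.addLeft a).image_frontier Ω).symm
  rw [himg] at hx
  obtain ⟨x, hx, rfl⟩ := hx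
  obtain ⟨ν, hν⟩ := hb x hx
  have hball : ∀ c, Metric.ball (a + c) r = (fun y => a + y) '' Metric.ball c r := fun c => by
    simp [add_comm]
  refine ⟨ν, hν.1, ?_, ?_⟩
  · rw [add_sub_assoc, hball]
    exact image_mono hν.2.1
  · rw [add_assoc, hball, ← image_compl_eq (AddGroup.addLeft_bijective a)]
    exact image_mono hν.2.2

end Components

/-! ### Reduction to uniformly bounded domains -/

section Reduction

variable {N : ℕ} {Ω : Set (EuclideanSpace ℝ (Fin N))} {r V : ℝ}

lemma volume_real_ball (x : EuclideanSpace ℝ (Fin N)) {ρ : ℝ} (hρ : 0 < ρ) :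
    volume.real (Metric.ball x ρ) =
      volume.real (Metric.ball (0 : EuclideanSpace ℝ (Fin N)) 1) * ρ ^ N := by
  rw [Measure.real, Measure.addHaar_ball_of_pos _ _ hρ, ENNReal.toReal_mul,
    ENNReal.toReal_ofReal (by positivity), finrank_euclideanSpace_fin, mul_comm]
  rfl

lemma volume_real_unitBall_pos :
    0 < volume.real (Metric.ball (0 : EuclideanSpace ℝ (Fin N)) 1) :=
  ENNReal.toReal_pos (Metric.measure_ball_pos _ _ one_pos).ne' measure_ball_lt_top.ne

lemma nonempty_compl_of_isBounded (hN : 1 ≤ N) (h : Bornology.IsBounded Ω) : Ωᶜ.Nonempty := by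
  have : Nonempty (Fin N) := ⟨⟨0, hN⟩⟩
  obtain ⟨R, hR⟩ := h.subset_closedBall 0
  obtain ⟨y, hy⟩ := NormedSpace.exists_lt_norm ℝ (EuclideanSpace ℝ (Fin N)) R
  refine ⟨y, fun hyΩ => ?_⟩
  have := mem_closedBall_zero_iff.1 (hR hyΩ)
  linarith

lemma le_volume_of_mem_sBall (hN : 1 ≤ N) (hr : 0 < r) (hΩ : Ω ∈ SBall N r) :
    volume.real (Metric.ball (0 : EuclideanSpace ℝ (Fin N)) 1) * r ^ N ≤ volume.real Ω := by
  obtain ⟨⟨b, hbΩ⟩, hop, hbd, hb⟩ := (mem_sBall_iff hr).1 hΩ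
  obtain ⟨y, -, hy⟩ := hb.exists_mem_ball_subset hr hop (nonempty_compl_of_isBounded hN hbd) hbΩ
  rw [← volume_real_ball y hr]
  exact measureReal_mono hy hbd.measure_lt_top.ne

/-- A connected domain of large diameter contains many disjoint balls of radius `r`, one near each of
a chain of points at distances `6 r k` from a fixed point. -/
lemma exists_dist_le_of_isPreconnected (hN : 1 ≤ N) (hr : 0 < r) (V : ℝ) :
    ∃ D, 0 ≤ D ∧ ∀ Ω ∈ SBall N r, IsPreconnected Ω → volume.real Ω ≤ V →
      ∀ x ∈ Ω, ∀ y ∈ Ω, dist y x ≤ D := by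
  set v₀ := volume.real (Metric.ball (0 : EuclideanSpace ℝ (Fin N)) 1) * r ^ N with hv₀
  have hv₀pos : 0 < v₀ := mul_pos volume_real_unitBall_pos (by positivity)
  obtain ⟨m, hm⟩ := exists_nat_gt (V / v₀)
  rw [div_lt_iff₀ hv₀pos] at hm
  refine ⟨6 * r * m, by positivity, fun Ω hΩ hpc hV x hx y hy => ?_⟩
  by_contra! hD
  obtain ⟨-, hop, hbd, hb⟩ := (mem_sBall_iff hr).1 hΩ
  have hz : ∀ k ∈ Finset.range m, ∃ z ∈ Ω, dist z x = 6 * r * k := by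
    intro k hk
    have hk' : (k : ℝ) ≤ m := by exact_mod_cast (Finset.mem_range.1 hk).le
    have := hpc.intermediate_value hx hy (f := fun z => dist z x)
      (continuous_id.dist continuous_const).continuousOn
    exact this ⟨by rw [dist_self]; positivity, (by gcongr : 6 * r * k ≤ 6 * r * m).trans hD.le⟩
  have hc : ∀ k : ℕ, ∃ c, k ∈ Finset.range m → Metric.ball c r ⊆ Ω ∧
      ∀ w ∈ Metric.ball c r, |dist w x - 6 * r * k| < 2 * r := by
    intro k
    by_cases hk : k ∈ Finset.range m
    swap
    · exact ⟨0, fun h => absurd h hk⟩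
    obtain ⟨z, hzΩ, hzx⟩ := hz k hk
    obtain ⟨c, hzc, hcΩ⟩ := hb.exists_mem_ball_subset hr hop (nonempty_compl_of_isBounded hN hbd) hzΩ
    refine ⟨c, fun _ => ⟨hcΩ, fun w hw => ?_⟩⟩
    rw [← hzx]
    refine (abs_dist_sub_le w z x).trans_lt ?_
    linarith [dist_triangle_right w z c, Metric.mem_ball.1 hw, Metric.mem_ball.1 hzc]
  choose c hc using hc
  have hdisj : (Finset.range m : Set ℕ).PairwiseDisjoint fun k => Metric.ball (c k) r := by
    intro j hj k hk hjk
    rw [Function.onFun, Set.disjoint_left]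
    intro w hwj hwk
    have h1 := abs_lt.1 ((hc j (by simpa using hj)).2 w hwj)
    have h2 := abs_lt.1 ((hc k (by simpa using hk)).2 w hwk)
    rcases lt_or_gt_of_ne hjk with h | h
    · have : (j : ℝ) + 1 ≤ k := by exact_mod_cast h
      nlinarith
    · have : (k : ℝ) + 1 ≤ j := by exact_mod_cast h
      nlinarith
  have hsum := measureReal_biUnion_finset (μ := volume) hdisj (fun _ _ => measurableSet_ball)
    (fun _ _ => measure_ball_lt_top.ne)
  have hle : volume.real (⋃ k ∈ Finset.range m, Metric.ball (c k) r) ≤ volume.real Ω :=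
    measureReal_mono (iUnion₂_subset fun k hk => (hc k hk).1) hbd.measure_lt_top.ne
  rw [hsum, Finset.sum_congr rfl fun k _ => volume_real_ball (c k) hr, Finset.sum_const,
    Finset.card_range, nsmul_eq_mul, ← hv₀] at hle
  linarith

variable {μ : Set (EuclideanSpace ℝ (Fin N)) → ℝ}

/-- By disjoint minimality, some connected piece of `Ω` has a value of `μ` at most that of `Ω`; the
remaining pieces, if there are any, have at least the volume of a ball of radius `r`. -/
lemma exists_isPreconnected_subset (hN : 1 ≤ N) (hr : 0 < r)
    (hunion : ∀ Ω₁ ∈ SubC N, ∀ Ω₂ ∈ SubC N,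
      closure Ω₁ ∩ closure Ω₂ = ∅ → μ (Ω₁ ∪ Ω₂) = min (μ Ω₁) (μ Ω₂)) :
    ∀ Ω ∈ SBall N r, ∃ A ∈ SBall N r, IsPreconnected A ∧ μ A ≤ μ Ω ∧
      (volume.real A = volume.real Ω ∨
        volume.real A + volume.real (Metric.ball (0 : EuclideanSpace ℝ (Fin N)) 1) * r ^ N
          ≤ volume.real Ω) := by
  set v₀ := volume.real (Metric.ball (0 : EuclideanSpace ℝ (Fin N)) 1) * r ^ N with hv₀
  have hv₀pos : 0 < v₀ := mul_pos volume_real_unitBall_pos (by positivity)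
  have key : ∀ n : ℕ, ∀ Ω ∈ SBall N r, volume.real Ω < n * v₀ →
      ∃ A ∈ SBall N r, IsPreconnected A ∧ μ A ≤ μ Ω ∧
        (volume.real A = volume.real Ω ∨ volume.real A + v₀ ≤ volume.real Ω) := by
    intro n
    induction n with
    | zero =>
      intro Ω _ hlt
      rw [Nat.cast_zero, zero_mul] at hlt
      exact absurd hlt (not_lt.2 measureReal_nonneg)
    | succ n ih =>
      intro Ω hΩ hlt
      by_cases hpc : IsPreconnected Ω
      · exact ⟨Ω, hΩ, hpc, le_rfl, Or.inl rfl⟩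
      obtain ⟨-, hop, hbd, hb⟩ := (mem_sBall_iff hr).1 hΩ
      rw [IsPreconnected] at hpc
      push Not at hpc
      obtain ⟨u, v, hu, hv, hsub, hneu, hnev, hemp⟩ := hpc
      have hunionΩ : Ω ∩ u ∪ Ω ∩ v = Ω := by
        rw [← inter_union_distrib_left, inter_eq_left.2 hsub]
      have hdisj : Disjoint (Ω ∩ u) (Ω ∩ v) := by
        rw [disjoint_iff_inter_eq_empty, ← inter_inter_distrib_left]
        exact hemp
      have hou := hop.inter hu
      have hov := hop.inter hv
      have hb' : HasTwoSidedBalls (Ω ∩ u ∪ Ω ∩ v) r := by rwa [hunionΩ]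
      have hb'' : HasTwoSidedBalls (Ω ∩ v ∪ Ω ∩ u) r := by rwa [union_comm]
      have hA : Ω ∩ u ∈ SBall N r := (hb'.left_of_union hr hou hov hdisj).mem_sBall hr hneu hou
        (hbd.subset inter_subset_left)
      have hB : Ω ∩ v ∈ SBall N r :=
        (hb''.left_of_union hr hov hou hdisj.symm).mem_sBall hr hnev hov
          (hbd.subset inter_subset_left)
      have hvol : volume.real (Ω ∩ u) + volume.real (Ω ∩ v) = volume.real Ω := by
        rw [← measureReal_union hdisj hov.measurableSet
          (hbd.subset inter_subset_left).measure_lt_top.ne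
          (hbd.subset inter_subset_left).measure_lt_top.ne, hunionΩ]
      have hμ : μ Ω = min (μ (Ω ∩ u)) (μ (Ω ∩ v)) := by
        rw [← hunion _ hA.1 _ hB.1 (hb'.closure_inter_closure hr hou hov hdisj), hunionΩ]
      have hvA := le_volume_of_mem_sBall hN hr hA
      have hvB := le_volume_of_mem_sBall hN hr hB
      rw [← hv₀] at hvA hvB
      push_cast at hlt
      obtain ⟨C, hC, hCμ, hCv⟩ : ∃ C ∈ SBall N r, μ C ≤ μ Ω ∧ volume.real C + v₀ ≤ volume.real Ω := by
        rcases min_choice (μ (Ω ∩ u)) (μ (Ω ∩ v)) with h | h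
        · exact ⟨_, hA, (hμ.trans h).ge, by linarith⟩
        · exact ⟨_, hB, (hμ.trans h).ge, by linarith⟩
      obtain ⟨A', hA', hpc', hμ', hv'⟩ := ih C hC (by linarith)
      exact ⟨A', hA', hpc', hμ'.trans hCμ, Or.inr (by rcases hv' with h | h <;> linarith)⟩
  intro Ω hΩ
  obtain ⟨n, hn⟩ := exists_nat_gt (volume.real Ω / v₀)
  exact key n Ω hΩ ((div_lt_iff₀ hv₀pos).1 hn)

lemma exists_radius_of_volume (hN : 1 ≤ N) (hr : 0 < r) {W : ℝ}
    (hW : volume.real (Metric.ball (0 : EuclideanSpace ℝ (Fin N)) 1) * r ^ N ≤ W) :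
    ∃ ρ, r ≤ ρ ∧ volume.real (Metric.ball (0 : EuclideanSpace ℝ (Fin N)) 1) * ρ ^ N = W := by
  set κ := volume.real (Metric.ball (0 : EuclideanSpace ℝ (Fin N)) 1) with hκ
  have hκ0 : 0 < κ := volume_real_unitBall_pos
  have hN0 : N ≠ 0 := by omega
  have h1 : r ^ N ≤ W / κ := by rw [le_div_iff₀ hκ0, mul_comm]; exact hW
  have h0 : 0 ≤ W / κ := (pow_nonneg hr.le N).trans h1
  have h2 : ((W / κ) ^ (N : ℝ)⁻¹) ^ N = W / κ := Real.rpow_inv_natCast_pow h0 hN0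
  refine ⟨(W / κ) ^ (N : ℝ)⁻¹, ?_, ?_⟩
  · exact le_of_pow_le_pow_left₀ hN0 (Real.rpow_nonneg h0 _) (h1.trans_eq h2.symm)
  · rw [h2, mul_div_cancel₀ _ hκ0.ne']

/-- Up to translation, the piece given by `exists_isPreconnected_subset` lies in a ball of fixed
radius. The remaining volume can be put into a single ball at a fixed place: adding a separated set
does not increase `μ`. -/
lemma exists_bounded_competitor (hN : 1 ≤ N) (hr : 0 < r)
    (hunion : ∀ Ω₁ ∈ SubC N, ∀ Ω₂ ∈ SubC N,
      closure Ω₁ ∩ closure Ω₂ = ∅ → μ (Ω₁ ∪ Ω₂) = min (μ Ω₁) (μ Ω₂))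
    (htrans : ∀ x : EuclideanSpace ℝ (Fin N), ∀ Ω ∈ SubC N,
      μ ((fun y => x + y) '' Ω) = μ Ω)
    (hV : volume.real (Metric.ball (0 : EuclideanSpace ℝ (Fin N)) 1) * r ^ N ≤ V) :
    ∃ R, ∀ Ω ∈ SBallVol N r V, ∃ Ω' ∈ SBallVol N r V, Ω' ⊆ Metric.closedBall 0 R ∧ μ Ω' ≤ μ Ω := by
  have : Nonempty (Fin N) := ⟨⟨0, hN⟩⟩
  obtain ⟨D, hD0, hD⟩ := exists_dist_le_of_isPreconnected hN hr V
  obtain ⟨ρ', hρ', hρ'V⟩ := exists_radius_of_volume hN hr hV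
  set κ := volume.real (Metric.ball (0 : EuclideanSpace ℝ (Fin N)) 1) with hκ
  have hκ0 : 0 < κ := volume_real_unitBall_pos
  obtain ⟨c, hc⟩ : ∃ c : EuclideanSpace ℝ (Fin N), ‖c‖ = D + ρ' + 2 * r :=
    exists_norm_eq _ (by have := hr.trans_le hρ'; positivity)
  refine ⟨‖c‖ + ρ', fun Ω hΩ => ?_⟩
  obtain ⟨A, hA, hpc, hμA, hvA⟩ := exists_isPreconnected_subset hN hr hunion Ω hΩ.1
  rw [hΩ.2] at hvA
  obtain ⟨⟨a, ha⟩, hop, hbd, hb⟩ := (mem_sBall_iff hr).1 hA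
  have hAV : volume.real A ≤ V := by
    have : 0 < κ * r ^ N := by positivity
    rcases hvA with h | h <;> linarith
  set A' := (fun y => -a + y) '' A with hA'
  have hA'op : IsOpen A' := (Homeomorph.addLeft (-a)).isOpenMap A hop
  have hA'b : HasTwoSidedBalls A' r := hb.image_add _
  have hA'sub : A' ⊆ Metric.closedBall 0 D := by
    rintro _ ⟨y, hy, rfl⟩
    beta_reduce
    rw [mem_closedBall_zero_iff, neg_add_eq_sub, ← dist_eq_norm]
    exact hD A hA hpc hAV a ha y hy
  have hA'bd : Bornology.IsBounded A' := Metric.isBounded_closedBall.subset hA'sub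
  have hA'S : A' ∈ SBall N r := hA'b.mem_sBall hr ⟨_, mem_image_of_mem _ ha⟩ hA'op hA'bd
  have hA'v : volume.real A' = volume.real A := by
    rw [Measure.real, Measure.real, hA', image_add_left, measure_preimage_add]
  have hA'μ : μ A' ≤ μ Ω := (htrans (-a) A hA.1).trans_le hμA
  rcases hvA with h | h
  · exact ⟨A', ⟨hA'S, hA'v.trans h⟩,
      hA'sub.trans (Metric.closedBall_subset_closedBall (by rw [hc]; linarith)), hA'μ⟩
  obtain ⟨ρ, hρ, hρv⟩ := exists_radius_of_volume hN hr (W := V - volume.real A) (by linarith)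
  have hρ0 : 0 < ρ := hr.trans_le hρ
  have hρρ' : ρ ≤ ρ' := by
    refine le_of_pow_le_pow_left₀ (n := N) (by omega) (by linarith)
      (le_of_mul_le_mul_left ?_ hκ0)
    rw [hρv, hρ'V]
    linarith [measureReal_nonneg (μ := volume) (s := A)]
  have hBsub : Metric.ball c ρ ⊆ Metric.closedBall 0 (‖c‖ + ρ') := fun y hy => by
    rw [mem_closedBall_zero_iff]
    have := mem_ball_iff_norm.1 hy
    linarith [norm_le_insert' y c]
  have hBS : Metric.ball c ρ ∈ SBall N r := (hasTwoSidedBalls_ball hr hρ).mem_sBall hr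
    (Metric.nonempty_ball.2 hρ0) Metric.isOpen_ball Metric.isBounded_ball
  have hdist : ∀ x ∈ A', ∀ y ∈ Metric.ball c ρ, 2 * r ≤ dist x y := fun x hx y hy => by
    have h1 := mem_closedBall_zero_iff.1 (hA'sub hx)
    have h2 := mem_ball_iff_norm'.1 hy
    have h3 := norm_sub_norm_le c y
    have h4 := norm_sub_norm_le y x
    rw [dist_comm, dist_eq_norm]
    linarith
  have hcl := closure_inter_closure_eq_empty_of_dist hr hdist
  have hdisj : Disjoint A' (Metric.ball c ρ) :=
    (disjoint_iff_inter_eq_empty.2 hcl).mono subset_closure subset_closure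
  refine ⟨A' ∪ Metric.ball c ρ, ⟨?_, ?_⟩, union_subset (hA'sub.trans
    (Metric.closedBall_subset_closedBall (by rw [hc]; linarith))) hBsub, ?_⟩
  · exact (hA'b.union (hasTwoSidedBalls_ball hr hρ) hA'op Metric.isOpen_ball hdist).mem_sBall hr
      (hBS.1.1.inr) (hA'op.union Metric.isOpen_ball) (hA'bd.union Metric.isBounded_ball)
  · rw [measureReal_union hdisj measurableSet_ball hA'bd.measure_lt_top.ne measure_ball_lt_top.ne,
      hA'v, volume_real_ball c hρ0, hρv]
    ring
  · rw [hunion A' hA'S.1 _ hBS.1 hcl]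
    exact (min_le_left _ _).trans hA'μ

end Reduction

end BallDomain

/-! ### Existence of a minimizer -/

theorem theorem2p6 (N : ℕ) (hN : 1 ≤ N)
    (μ : Set (EuclideanSpace ℝ (Fin N)) → ℝ)
    (hpos : ∀ Ω ∈ BallDomain.SubC N, 0 < μ Ω)
    (hmono : ∀ Ω₁ ∈ BallDomain.SubC N, ∀ Ω₂ ∈ BallDomain.SubC N, Ω₁ ⊆ Ω₂ → μ Ω₂ ≤ μ Ω₁)
    (hflow : ∀ Ω ∈ BallDomain.SubC N,
      ∀ X : EuclideanSpace ℝ (Fin N) → EuclideanSpace ℝ (Fin N),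
      ContDiff ℝ ∞ X → HasCompactSupport X → BallDomain.IsOutwardPointing Ω X →
      ∀ ψ : ℝ → EuclideanSpace ℝ (Fin N) → EuclideanSpace ℝ (Fin N),
      BallDomain.IsGlobalFlow X ψ →
      Tendsto (fun t => μ (ψ t '' Ω)) (𝓝[>] 0) (𝓝 (μ Ω)))
    (hunion : ∀ Ω₁ ∈ BallDomain.SubC N, ∀ Ω₂ ∈ BallDomain.SubC N,
      closure Ω₁ ∩ closure Ω₂ = ∅ → μ (Ω₁ ∪ Ω₂) = min (μ Ω₁) (μ Ω₂))
    (htrans : ∀ x : EuclideanSpace ℝ (Fin N), ∀ Ω ∈ BallDomain.SubC N,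
      μ ((fun y => x + y) '' Ω) = μ Ω)
    (r₀ V : ℝ) (hr₀ : 0 < r₀)
    (hV : volume.real (Metric.ball (0 : EuclideanSpace ℝ (Fin N)) 1) * r₀ ^ N ≤ V) :
    ∃ Ω ∈ BallDomain.SBallVol N r₀ V, ∀ Ω' ∈ BallDomain.SBallVol N r₀ V, μ Ω ≤ μ Ω' := by
  obtain ⟨R, hR⟩ := BallDomain.exists_bounded_competitor hN hr₀ hunion htrans hV
  set m := sInf (μ '' BallDomain.SBallVol N r₀ V) with hm
  have hne : (μ '' BallDomain.SBallVol N r₀ V).Nonempty := by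
    obtain ⟨ρ, hρ, hρV⟩ := BallDomain.exists_radius_of_volume hN hr₀ hV
    have hρ0 : 0 < ρ := hr₀.trans_le hρ
    refine ⟨_, Metric.ball 0 ρ, ⟨?_, ?_⟩, rfl⟩
    · exact (BallDomain.hasTwoSidedBalls_ball hr₀ hρ).mem_sBall hr₀
        (Metric.nonempty_ball.2 hρ0) Metric.isOpen_ball Metric.isBounded_ball
    · rw [BallDomain.volume_real_ball _ hρ0, hρV]
  have hbdd : BddBelow (μ '' BallDomain.SBallVol N r₀ V) :=
    ⟨0, by rintro _ ⟨Ω, hΩ, rfl⟩; exact (hpos Ω hΩ.1.1).le⟩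
  have hseq : ∀ n : ℕ, ∃ Ω ∈ BallDomain.SBallVol N r₀ V, Ω ⊆ Metric.closedBall 0 R ∧
      μ Ω ≤ m + 1 / ((n : ℝ) + 1) := by
    intro n
    obtain ⟨_, ⟨Ω, hΩ, rfl⟩, hlt⟩ := exists_lt_of_csInf_lt hne
      (lt_add_of_pos_right m (by positivity : 0 < 1 / ((n : ℝ) + 1)))
    obtain ⟨Ω', hΩ', hsub, hle⟩ := hR Ω hΩ
    exact ⟨Ω', hΩ', hsub, hle.trans hlt.le⟩
  choose Ω hΩ hΩR hΩμ using hseq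
  obtain ⟨Ω', hΩ', hout⟩ := BallDomain.exists_limit_sBallVol (hyperfilter ℕ) hN hr₀ hΩ hΩR
  refine ⟨Ω', hΩ', fun Ω'' hΩ'' => le_trans ?_ (csInf_le hbdd (mem_image_of_mem μ hΩ''))⟩
  refine ge_of_tendsto (b := μ Ω') (f := fun n : ℕ => m + 1 / ((n : ℝ) + 1)) (x := atTop)
    (by simpa using tendsto_one_div_add_atTop_nhds_zero_nat.const_add m)
    (Eventually.of_forall fun k => ?_)
  refine BallDomain.le_of_forall_isOpen_exists_subset hmono hflow hr₀ hΩ'.1 fun O hO hsub => ?_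
  have hge : ∀ᶠ n in hyperfilter ℕ, k ≤ n := Nat.hyperfilter_le_atTop (eventually_ge_atTop k)
  obtain ⟨n, hn, hkn⟩ := ((hout O hO hsub).and hge).exists
  refine ⟨Ω n, (hΩ n).1.1, hn, (hΩμ n).trans ?_⟩
  gcongr
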